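/- Let $V:\mathbb R\to\mathbb R$ be a real, integrable function ($\|V\|_1=\int_0^\infty|V(r)|\,dr<\infty$), not almost everywhere zero, that vanishes outside $[0,R_V]$ and satisfies $\sup(\operatorname{supp}V)=R_V$. Assume that there are $M\in\mathbb N$, exponents $-1<\delta_0<\dots<\delta_M$ and real coefficients $d_0,\dots,d_M$, not all zero, with $$V(r)\sim\sum_{n=0}^M d_n\,(R_V-r)^{\delta_n}\qquad\text{as } r\to R_V^-,$$ where $\sim$ means that the quotient of the two sides tends to $1$. For $k\in\mathbb C$ let $\varphi(k,\cdot)$ and $f(k,\cdot)$ be the solutions on $[0,\infty)$ of the radial Schrödinger equation $-u''+Vu=k^2u$ ($u'$ locally absolutely continuous, equation almost everywhere) with $\varphi(k,0)=0$, $\varphi'(k,0)=1$, and with $f(k,r)=e^{ikr}$ for $r\ge R_V$, respectively. Let $$F(k)=f(k,r)\,\varphi'(k,r)-f'(k,r)\,\varphi(k,r)$$ be the Jost function; the Wronskian on the right does not depend on $r\ge0$. For a function $g:\mathbb C\to\mathbb C$ let $M_g(r)=\sup_{\theta\in[0,2\pi]}|g(re^{i\theta})|$. The function $g$ has order $\rho\in[0,\infty)$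 if $M_g(r)=O(e^{r^{\rho+\epsilon}})$ as $r\to\infty$ for every $\epsilon>0$ but for no $\epsilon<0$. If $g$ has order $\rho\in(0,\infty)$, it has type $\tau\in[0,\infty)$ if $M_g(r)=O(e^{(\tau+\epsilon)r^\rho})$ as $r\to\infty$ for every $\epsilon>0$ but for no $\epsilon<0$. An entire function is of exponential type if it has order one and finite type, or order less than one. The convergence exponent of the zeros of $g$ is the infimum of the $\alpha>0$ such that $\sum_n|z_n|^{-\alpha}<\infty$, where $(z_n)$ are the zeros of $g$ other than the origin, repeated according to multiplicity. Then $F$ is an entire function of order one and type $2R_V$, hence of exponential type, and the convergence exponent of its zeros is one. -/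

import Mathlib

open MeasureTheory Filter Set
open scoped Topology

noncomputable section

namespace JostScattering

/-! ### Solutions of the radial Schrödinger equation -/

/-- Derivative `∂ᵣ u` of a function on the half-line `[0, ∞)` (one-sided at `0`). -/
def radialDeriv (u : ℝ → ℂ) (r : ℝ) : ℂ :=
  derivWithin u (Ici 0) r

/-- `u` solves `-u'' + V u = k² u` on `[0, ∞)` in the (Carathéodory) sense that is appropriate for
an integrable potential: `u` is differentiable, and `u'` is the locally absolutely continuous
function that is obtained by integrating `u'' = (V - k²) u`. -/
structure IsSchrodingerSolution (V : ℝ → ℝ) (k : ℂ) (u : ℝ → ℂ) : Prop where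
  differentiableOn : DifferentiableOn ℝ u (Ici 0)
  radialDeriv_eq : ∀ r, 0 ≤ r →
    radialDeriv u r = radialDeriv u 0 + ∫ s in (0 : ℝ)..r, ((V s : ℂ) - k ^ 2) * u s

/-- The regular eigenfunction `φ(k, ·)`: the solution with `φ(k, 0) = 0` and `φ'(k, 0) = 1`. -/
structure IsRegularEigenfunction (V : ℝ → ℝ) (k : ℂ) (u : ℝ → ℂ) : Prop where
  isSolution : IsSchrodingerSolution V k u
  value_zero : u 0 = 0
  deriv_zero : radialDeriv u 0 = 1

/-- The irregular eigenfunction `f(k, ·)`: the solution with `f(k, r) = e^{ikr}` for `r ≥ R`. -/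
structure IsIrregularEigenfunction (V : ℝ → ℝ) (R : ℝ) (k : ℂ) (u : ℝ → ℂ) : Prop where
  isSolution : IsSchrodingerSolution V k u
  eq_exp : ∀ r, R ≤ r → u r = Complex.exp (Complex.I * k * r)

/-- The regular eigenfunction `r ↦ φ(k, r)`. -/
def regularEigenfunction (V : ℝ → ℝ) (k : ℂ) : ℝ → ℂ :=
  Classical.epsilon (IsRegularEigenfunction V k)

/-- The irregular eigenfunction `r ↦ f(k, r)`. -/
def irregularEigenfunction (V : ℝ → ℝ) (R : ℝ) (k : ℂ) : ℝ → ℂ :=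
  Classical.epsilon (IsIrregularEigenfunction V R k)

/-- The Wronskian `W(u, v) = u v' - u' v` at the point `r`. -/
def wronskian (u v : ℝ → ℂ) (r : ℝ) : ℂ :=
  u r * radialDeriv v r - radialDeriv u r * v r

/-- The Jost function `F(k) = W(f(k, ·), φ(k, ·))`. The Wronskian does not depend on the point
`r ≥ 0` (see `IsSchrodingerSolution.wronskian_eq`); it is evaluated at `r = 0`. -/
def jostFunction (V : ℝ → ℝ) (R : ℝ) (k : ℂ) : ℂ :=
  wronskian (irregularEigenfunction V R k) (regularEigenfunction V k) 0

theorem absolutelyContinuousOnInterval_integral {g : ℝ → ℂ} {b : ℝ}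
    (hg : IntervalIntegrable g volume 0 b) :
    AbsolutelyContinuousOnInterval (fun r => ∫ s in (0 : ℝ)..r, g s) 0 b := by
  have hN := hg.norm.absolutelyContinuousOnInterval_intervalIntegral (c := 0) (by simp)
  rw [absolutelyContinuousOnInterval_iff] at hN ⊢
  intro ε hε
  obtain ⟨δ, hδ, h⟩ := hN ε hε
  refine ⟨δ, hδ, fun E hE hlt => lt_of_le_of_lt (Finset.sum_le_sum fun i hi => ?_) (h E hE hlt)⟩
  have hmem := hE.1 i hi
  have h1 : IntervalIntegrable g volume 0 (E.2 i).1 :=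
    hg.mono_set (uIcc_subset_uIcc (by simp) hmem.1)
  have h2 : IntervalIntegrable g volume 0 (E.2 i).2 :=
    hg.mono_set (uIcc_subset_uIcc (by simp) hmem.2)
  rw [dist_comm, dist_comm (∫ s in (0 : ℝ)..(E.2 i).1, ‖g s‖), dist_eq_norm, Real.dist_eq,
    intervalIntegral.integral_interval_sub_left h2 h1,
    intervalIntegral.integral_interval_sub_left h2.norm h1.norm]
  exact intervalIntegral.norm_integral_le_abs_integral_norm

theorem IsSchrodingerSolution.intervalIntegrable {V : ℝ → ℝ} {k : ℂ} {u : ℝ → ℂ}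
    (hV : Integrable V) (hu : IsSchrodingerSolution V k u) {b : ℝ} (hb : 0 ≤ b) :
    IntervalIntegrable (fun s => ((V s : ℂ) - k ^ 2) * u s) volume 0 b := by
  have hc : ContinuousOn u (uIcc 0 b) := by
    rw [uIcc_of_le hb]
    exact hu.differentiableOn.continuousOn.mono fun x hx => hx.1
  have hV' : IntervalIntegrable (fun s => (V s : ℂ)) volume 0 b :=
    hV.ofReal.intervalIntegrable
  exact (hV'.sub intervalIntegrable_const).mul_continuousOn hc

theorem IsSchrodingerSolution.deriv_absolutelyContinuous {V : ℝ → ℝ} {k : ℂ} {u : ℝ → ℂ}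
    (hV : Integrable V) (hu : IsSchrodingerSolution V k u) {b : ℝ} (hb : 0 ≤ b) :
    AbsolutelyContinuousOnInterval (radialDeriv u) 0 b := by
  have h := absolutelyContinuousOnInterval_integral (hu.intervalIntegrable hV hb)
  rw [absolutelyContinuousOnInterval_iff] at h ⊢
  intro ε hε
  obtain ⟨δ, hδ, h⟩ := h ε hε
  refine ⟨δ, hδ, fun E hE hlt => lt_of_le_of_lt (Finset.sum_le_sum fun i hi => ?_) (h E hE hlt)⟩
  have hmem := hE.1 i hi
  rw [uIcc_of_le hb] at hmem
  rw [hu.radialDeriv_eq _ hmem.1.1, hu.radialDeriv_eq _ hmem.2.1, dist_add_left]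

theorem IsSchrodingerSolution.absolutelyContinuous {V : ℝ → ℝ} {k : ℂ} {u : ℝ → ℂ}
    (hV : Integrable V) (hu : IsSchrodingerSolution V k u) {b : ℝ} (hb : 0 ≤ b) :
    AbsolutelyContinuousOnInterval u 0 b := by
  obtain ⟨C, hC⟩ := (hu.deriv_absolutelyContinuous hV hb).exists_bound
  rw [uIcc_of_le hb] at hC
  have hL : LipschitzOnWith C.toNNReal u (uIcc 0 b) := by
    rw [uIcc_of_le hb]
    refine (convex_Icc 0 b).lipschitzOnWith_of_nnnorm_hasDerivWithin_le
      (f' := radialDeriv u) (fun x hx => ?_) fun x hx => ?_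
    · exact ((hu.differentiableOn x hx.1).hasDerivWithinAt).mono fun y hy => hy.1
    · rw [← NNReal.coe_le_coe, coe_nnnorm]
      exact (hC x hx).trans (Real.le_coe_toNNReal C)
  exact hL.absolutelyContinuousOnInterval

theorem IsSchrodingerSolution.ae_hasDerivAt {V : ℝ → ℝ} {k : ℂ} {u : ℝ → ℂ}
    (hV : Integrable V) (hu : IsSchrodingerSolution V k u) {b : ℝ} (hb : 0 ≤ b) :
    ∀ᵐ r, r ∈ uIcc 0 b → HasDerivAt u (radialDeriv u r) r ∧
      HasDerivAt (radialDeriv u) (((V r : ℂ) - k ^ 2) * u r) r := by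
  have h0 : ∀ᵐ r : ℝ, r ≠ 0 := by simp [ae_iff, measure_singleton]
  filter_upwards [(hu.intervalIntegrable hV hb).ae_hasDerivAt_integral, h0] with r hr hr0 hmem
  have hr1 := hr hmem 0 (by simp)
  rw [uIcc_of_le hb] at hmem
  have hpos : 0 < r := lt_of_le_of_ne hmem.1 (Ne.symm hr0)
  constructor
  · exact (hu.differentiableOn r hmem.1).hasDerivWithinAt.hasDerivAt (Ici_mem_nhds hpos)
  · refine (hr1.const_add (radialDeriv u 0)).congr_of_eventuallyEq ?_
    filter_upwards [Ici_mem_nhds hpos] with s hs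
    exact hu.radialDeriv_eq s hs

/-- The Wronskian of two solutions at the same energy is constant. -/
theorem IsSchrodingerSolution.wronskian_eq {V : ℝ → ℝ} {k : ℂ} {u v : ℝ → ℂ}
    (hV : Integrable V) (hu : IsSchrodingerSolution V k u) (hv : IsSchrodingerSolution V k v)
    {r : ℝ} (hr : 0 ≤ r) : wronskian u v r = wronskian u v 0 := by
  have hac : AbsolutelyContinuousOnInterval (wronskian u v) 0 r :=
    ((hu.absolutelyContinuous hV hr).smul (hv.deriv_absolutelyContinuous hV hr)).sub
      ((hu.deriv_absolutelyContinuous hV hr).smul (hv.absolutelyContinuous hV hr))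
  obtain ⟨C, hC⟩ := hac.const_of_ae_hasDerivAt_zero (by
    filter_upwards [hu.ae_hasDerivAt hV hr, hv.ae_hasDerivAt hV hr] with s h1 h2 hs
    obtain ⟨a1, a2⟩ := h1 hs
    obtain ⟨b1, b2⟩ := h2 hs
    have h := (a1.mul b2).sub (a2.mul b1)
    have e : radialDeriv u s * radialDeriv v s + u s * (((V s : ℂ) - k ^ 2) * v s) -
        (((V s : ℂ) - k ^ 2) * u s * v s + radialDeriv u s * radialDeriv v s) = 0 := by ring
    rw [e] at h
    exact h)
  rw [hC r (by simp), hC 0 (by simp)]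

/-! ### Growth of entire functions -/

/-- The maximum modulus `M(r) = sup_{θ ∈ [0, 2π]} |f(r e^{iθ})|`. -/
def maxModulus (f : ℂ → ℂ) (r : ℝ) : ℝ :=
  sSup ((fun θ : ℝ => ‖f (r * Complex.exp (Complex.I * θ))‖) '' Icc 0 (2 * Real.pi))

/-- `f` is of (finite) order `ρ`: the bound `M(r) = O(exp(r ^ (ρ + ε)))` holds for every positive
`ε`, but for no negative `ε`. -/
structure HasOrder (f : ℂ → ℂ) (ρ : ℝ) : Prop where
  nonneg : 0 ≤ ρ
  isBigO : ∀ ε : ℝ, 0 < ε → maxModulus f =O[atTop] fun r : ℝ => Real.exp (r ^ (ρ + ε))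
  not_isBigO : ∀ ε : ℝ, ε < 0 → ¬ maxModulus f =O[atTop] fun r : ℝ => Real.exp (r ^ (ρ + ε))

/-- `f` is of finite order `ρ > 0` and of (finite) type `τ`: the bound
`M(r) = O(exp((τ + ε) r ^ ρ))` holds for every positive `ε`, but for no negative `ε`. -/
structure HasOrderAndType (f : ℂ → ℂ) (ρ τ : ℝ) : Prop where
  hasOrder : HasOrder f ρ
  order_pos : 0 < ρ
  nonneg : 0 ≤ τ
  isBigO : ∀ ε : ℝ, 0 < ε → maxModulus f =O[atTop] fun r : ℝ => Real.exp ((τ + ε) * r ^ ρ)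
  not_isBigO : ∀ ε : ℝ, ε < 0 →
    ¬ maxModulus f =O[atTop] fun r : ℝ => Real.exp ((τ + ε) * r ^ ρ)

/-- An entire function is of exponential type if it has order one and finite type, or order less
than one. -/
def IsOfExponentialType (f : ℂ → ℂ) : Prop :=
  Differentiable ℂ f ∧ ((∃ τ, HasOrderAndType f 1 τ) ∨ ∃ ρ, ρ < 1 ∧ HasOrder f ρ)

/-- The zeros of `f` other than the origin have convergence exponent `a`: it is the infimum of the
`α > 0` with `∑ 1 / |zₙ| ^ α < ∞`, where every zero is repeated according to its multiplicity. -/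
def HasConvergenceExponent (f : ℂ → ℂ) (a : ℝ) : Prop :=
  IsGLB {α : ℝ | 0 < α ∧ Summable fun z : {z : ℂ // f z = 0 ∧ z ≠ 0} =>
    (analyticOrderNatAt f z : ℝ) * (1 / ‖(z : ℂ)‖ ^ α)} a

end JostScattering

end

noncomputable section

namespace JostScattering

/-! ### Calculus of absolutely continuous functions -/

/-! Evaluating the Wronskian at the origin, where φ = 0 and φ' = 1, gives F(k) = f(k, 0)
(`jostFunction_eq`). After the reflection r ↦ R - r, f(k, ·) solves a Volterra equation with initial
data entire in k and an operator of the form T - k²S. The iterates of a Volterra operator decay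
factorially, so 1 - (T - k²S) is always invertible, its inverse is holomorphic in k, and F is entire
(`differentiable_jostFunction`).

Upper growth comes from the integral equation for e^{-ikr} f(k, r). For |k| ≥ 2‖V‖₁ the integral
term is absorbed by the left side, which yields |F(k)| ≤ 2 e^{2R|k|} (`norm_jostFunction_le`) and,
for Im k ≥ 0, F(k) = 1 + O(1/|k|) (`norm_jostFunction_sub_one_le`).

Lower growth is found on the negative imaginary axis. There 2κ(F(-iκ) - 1) equals ∫ (e^{2κs} - 1)
V(s) ds up to an error of relative size 1/κ, measured against ∫ e^{2κs} |V|
(`norm_jostFunction_sub_born_le`). The asymptotics at R serve only to give V a constant sign just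
left of R. No cancellation can then occur where e^{2κs} is largest, and |F(-iκ)| ≥ e^{(2R-ε)κ}
eventually (`eventually_exp_le_norm_jostFunction`). Together the two bounds give order one and type
2R.

For the zeros, exponential growth forces at most O(ρ) of them in |z| ≤ ρ, so the convergence
exponent is at most one (`summable_order_div_rpow`). If some α < 1 made the sum converge, F would
be, up to a power of z, a canonical product of genus zero times e^{a+bz}. In F(z)F(-z) the linear
exponent cancels, so this product would be O(e^{A|z|^α}) up to a power
(`norm_mul_neg_le_of_summable`). But F(iκ) → 1 while F(-iκ) grows exponentially, a contradiction
(`hasConvergenceExponent_one`). -/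

/-- Fundamental theorem of calculus for absolutely continuous complex functions. -/
theorem eq_add_integral_of_absolutelyContinuous {f g : ℝ → ℂ} {b : ℝ}
    (hf : AbsolutelyContinuousOnInterval f 0 b) (hg : IntervalIntegrable g volume 0 b)
    (hfg : ∀ᵐ x, x ∈ uIcc 0 b → HasDerivAt f (g x) x) {r : ℝ} (hr : r ∈ uIcc 0 b) :
    f r = f 0 + ∫ s in (0 : ℝ)..r, g s := by
  obtain ⟨C, hC⟩ :=
    (hf.sub (absolutelyContinuousOnInterval_integral hg)).const_of_ae_hasDerivAt_zero (by
      filter_upwards [hg.ae_hasDerivAt_integral, hfg] with x h1 h2 hx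
      simpa using (h2 hx).sub (h1 hx 0 (by simp)))
  have h1 := hC r hr
  have h2 := hC 0 (by simp)
  simp only [Pi.sub_apply, intervalIntegral.integral_same, sub_zero] at h1 h2
  rw [h2, ← h1]
  ring

theorem absolutelyContinuousOnInterval_pow {f : ℝ → ℝ} {a b : ℝ}
    (hf : AbsolutelyContinuousOnInterval f a b) (n : ℕ) :
    AbsolutelyContinuousOnInterval (fun x => f x ^ (n + 1)) a b := by
  induction n with
  | zero => simpa using hf
  | succ n ih => simpa only [pow_succ _ (n + 1)] using ih.fun_mul hf

/-- Since `g` is merely integrable, the chain rule for a power of its primitive holds only almost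
everywhere; absolute continuity of the power is what allows integrating it back. The divisor n + 1
is the source of the factorial in the bound for Volterra iterates. -/
theorem integral_mul_primitive_pow {g : ℝ → ℝ} {b : ℝ} (hg : IntervalIntegrable g volume 0 b)
    (n : ℕ) {r : ℝ} (hr : r ∈ uIcc 0 b) :
    ∫ s in (0 : ℝ)..r, g s * (∫ t in (0 : ℝ)..s, g t) ^ n =
      (∫ t in (0 : ℝ)..r, g t) ^ (n + 1) / (n + 1) := by
  have hgr : IntervalIntegrable g volume 0 r := hg.mono_set (uIcc_subset_uIcc (by simp) hr)
  have h := (absolutelyContinuousOnInterval_pow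
    (hgr.absolutelyContinuousOnInterval_intervalIntegral (c := 0) (by simp))
      n).integral_deriv_eq_sub
  have h2 : ∫ s in (0 : ℝ)..r, deriv (fun x => (∫ t in (0 : ℝ)..x, g t) ^ (n + 1)) s =
      ∫ s in (0 : ℝ)..r, (n + 1) * (g s * (∫ t in (0 : ℝ)..s, g t) ^ n) := by
    refine intervalIntegral.integral_congr_ae ?_
    filter_upwards [hgr.ae_hasDerivAt_integral] with x hx hxm
    have := ((hx (uIoc_subset_uIcc hxm) 0 (by simp)).pow (n + 1)).deriv
    rw [show (fun x => (∫ t in (0 : ℝ)..x, g t) ^ (n + 1)) =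
      (fun x => ∫ t in (0 : ℝ)..x, g t) ^ (n + 1) from rfl, this]
    simp only [Nat.cast_add, Nat.cast_one, add_tsub_cancel_right]
    ring
  rw [h2, intervalIntegral.integral_const_mul] at h
  simp only [intervalIntegral.integral_same] at h
  rw [eq_div_iff (by positivity), mul_comm, h]
  simp

/-! ### The Volterra operator of a second order equation -/

/-- 1 - T^n is the product of 1 - T and a geometric sum that commutes with it. Hence one contracting
power of T suffices and T itself need not be small. -/
theorem isUnit_one_sub_of_pow {A : Type*} [Ring A] (T : A) (n : ℕ) (h : IsUnit (1 - T ^ n)) :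
    IsUnit (1 - T) := by
  rw [← mul_neg_geom_sum] at h
  have hcomm : Commute (1 - T) (∑ i ∈ Finset.range n, T ^ i) :=
    Commute.sum_right _ _ _ fun i _ =>
      ((Commute.one_left _).sub_left (Commute.refl T)).pow_right i
  exact (hcomm.isUnit_mul_iff.1 h).1

section Volterra

variable {b : ℝ} (hb : 0 ≤ b) {q : ℝ → ℂ}

theorem intervalIntegrable_mul_IccExtend (hq : IntervalIntegrable q volume 0 b)
    (u : C(Icc (0 : ℝ) b, ℂ)) :
    IntervalIntegrable (fun s => q s * IccExtend hb u s) volume 0 b :=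
  hq.mul_continuousOn u.continuous.Icc_extend'.continuousOn

theorem continuousOn_inner_integral (hq : IntervalIntegrable q volume 0 b)
    (u : C(Icc (0 : ℝ) b, ℂ)) :
    ContinuousOn (fun s => ∫ t in (0 : ℝ)..s, q t * IccExtend hb u t) (Icc 0 b) := by
  have := (absolutelyContinuousOnInterval_integral
    (intervalIntegrable_mul_IccExtend hb hq u)).continuousOn
  rwa [uIcc_of_le hb] at this

theorem intervalIntegrable_inner_integral (hq : IntervalIntegrable q volume 0 b)
    (u : C(Icc (0 : ℝ) b, ℂ)) {r : ℝ} (hr : r ∈ Icc 0 b) :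
    IntervalIntegrable (fun s => ∫ t in (0 : ℝ)..s, q t * IccExtend hb u t) volume 0 r := by
  refine ContinuousOn.intervalIntegrable ((continuousOn_inner_integral hb hq u).mono ?_)
  rw [uIcc_of_le hr.1]
  exact Icc_subset_Icc_right hr.2

/-- The operator `u ↦ ∫₀ʳ ∫₀ˢ q u` on continuous functions on `[0, b]`. -/
def volterraFun (hq : IntervalIntegrable q volume 0 b) (u : C(Icc (0 : ℝ) b, ℂ)) :
    C(Icc (0 : ℝ) b, ℂ) where
  toFun r := ∫ s in (0 : ℝ)..r, ∫ t in (0 : ℝ)..s, q t * IccExtend hb u t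
  continuous_toFun := by
    have := (absolutelyContinuousOnInterval_integral
      (intervalIntegrable_inner_integral hb hq u (right_mem_Icc.2 hb))).continuousOn
    rw [uIcc_of_le hb] at this
    exact continuousOn_iff_continuous_domRestrict.1 this

/-- Induction step for the iterates. With W the primitive of ‖q‖, the inner integral gains W/(n+1);
the outer one costs only the length b, because W is monotone and can be replaced by its value at r.
-/
theorem norm_volterraFun_apply_le (hq : IntervalIntegrable q volume 0 b)
    (u : C(Icc (0 : ℝ) b, ℂ)) {C : ℝ} (hC : 0 ≤ C) (n : ℕ)
    (hu : ∀ r : Icc (0 : ℝ) b, ‖u r‖ ≤ C * (∫ t in (0 : ℝ)..r, ‖q t‖) ^ n)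
    (r : Icc (0 : ℝ) b) :
    ‖volterraFun hb hq u r‖ ≤
      b * C / (n + 1) * (∫ t in (0 : ℝ)..r, ‖q t‖) ^ (n + 1) := by
  have hqn (s : ℝ) (hs : s ∈ Icc 0 b) : IntervalIntegrable (fun t => ‖q t‖) volume 0 s :=
    hq.norm.mono_set (uIcc_subset_uIcc (by simp) (by rwa [uIcc_of_le hb]))
  have hmono (s s' : ℝ) (hs : 0 ≤ s) (hss : s ≤ s') (hs' : s' ≤ b) :
      ∫ t in (0 : ℝ)..s, ‖q t‖ ≤ ∫ t in (0 : ℝ)..s', ‖q t‖ :=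
    intervalIntegral.integral_mono_interval le_rfl hs hss
      (Eventually.of_forall fun _ => norm_nonneg _) (hqn s' ⟨hs.trans hss, hs'⟩)
  have hnn (s : ℝ) (hs : 0 ≤ s) : 0 ≤ ∫ t in (0 : ℝ)..s, ‖q t‖ :=
    intervalIntegral.integral_nonneg hs fun _ _ => norm_nonneg _
  have inner (s : ℝ) (hs : s ∈ Icc 0 b) : ‖∫ t in (0 : ℝ)..s, q t * IccExtend hb u t‖ ≤
      C / (n + 1) * (∫ t in (0 : ℝ)..s, ‖q t‖) ^ (n + 1) := by
    have hWc : ContinuousOn (fun t => (∫ x in (0 : ℝ)..t, ‖q x‖) ^ n) (uIcc 0 s) := by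
      have := ((hqn s hs).absolutelyContinuousOnInterval_intervalIntegral
        (c := 0) (by simp)).continuousOn
      exact this.pow n
    calc ‖∫ t in (0 : ℝ)..s, q t * IccExtend hb u t‖
        ≤ ∫ t in (0 : ℝ)..s, C * (‖q t‖ * (∫ x in (0 : ℝ)..t, ‖q x‖) ^ n) := by
          refine intervalIntegral.norm_integral_le_of_norm_le hs.1
            (Eventually.of_forall fun t ht => ?_)
            (((hqn s hs).mul_continuousOn hWc).const_mul C)
          rw [norm_mul, IccExtend_of_mem hb u ⟨ht.1.le, ht.2.trans hs.2⟩]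
          have := hu ⟨t, ht.1.le, ht.2.trans hs.2⟩
          calc _ ≤ ‖q t‖ * _ := mul_le_mul_of_nonneg_left this (norm_nonneg _)
            _ = _ := by ring
      _ = _ := by
          rw [intervalIntegral.integral_const_mul, integral_mul_primitive_pow hq.norm n
            (by rwa [uIcc_of_le hb])]
          ring
  have hr := r.2
  have h1 : ∀ s ∈ Set.uIoc (0 : ℝ) r, ‖∫ t in (0 : ℝ)..s, q t * IccExtend hb u t‖ ≤
      C / (n + 1) * (∫ t in (0 : ℝ)..r, ‖q t‖) ^ (n + 1) := fun s hs => by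
    rw [uIoc_of_le hr.1] at hs
    refine (inner s ⟨hs.1.le, hs.2.trans hr.2⟩).trans ?_
    have := hmono s r hs.1.le hs.2 hr.2
    have := hnn s hs.1.le
    gcongr
  have h2 := intervalIntegral.norm_integral_le_of_norm_le_const h1
  rw [sub_zero, abs_of_nonneg hr.1] at h2
  refine h2.trans ?_
  have := hnn r hr.1
  calc _ ≤ C / (n + 1) * (∫ t in (0 : ℝ)..r, ‖q t‖) ^ (n + 1) * b := by
        gcongr
        exact hr.2
    _ = _ := by ring

/-- The bounded operator `u ↦ ∫₀ʳ ∫₀ˢ q u`. -/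
def volterra (hq : IntervalIntegrable q volume 0 b) :
    C(Icc (0 : ℝ) b, ℂ) →L[ℂ] C(Icc (0 : ℝ) b, ℂ) :=
  LinearMap.mkContinuous
    { toFun := volterraFun hb hq
      map_add' := fun u v => by
        ext r
        change ∫ s in (0 : ℝ)..r, ∫ t in (0 : ℝ)..s, q t * IccExtend hb (u + v) t =
          (∫ s in (0 : ℝ)..r, ∫ t in (0 : ℝ)..s, q t * IccExtend hb u t) +
            ∫ s in (0 : ℝ)..r, ∫ t in (0 : ℝ)..s, q t * IccExtend hb v t
        rw [← intervalIntegral.integral_add (intervalIntegrable_inner_integral hb hq u r.2)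
          (intervalIntegrable_inner_integral hb hq v r.2)]
        refine intervalIntegral.integral_congr fun s hs => ?_
        have hs' : s ∈ uIcc 0 b := by
          rw [uIcc_of_le r.2.1] at hs
          rw [uIcc_of_le hb]
          exact ⟨hs.1, hs.2.trans r.2.2⟩
        have hi (w : C(Icc (0 : ℝ) b, ℂ)) := (intervalIntegrable_mul_IccExtend hb hq w).mono_set
          (uIcc_subset_uIcc left_mem_uIcc hs')
        rw [← intervalIntegral.integral_add (hi u) (hi v)]
        refine intervalIntegral.integral_congr fun t ht => ?_
        simp [IccExtend, mul_add]
      map_smul' := fun c u => by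
        ext r
        change ∫ s in (0 : ℝ)..r, ∫ t in (0 : ℝ)..s, q t * IccExtend hb (c • u) t =
          c * (∫ s in (0 : ℝ)..r, ∫ t in (0 : ℝ)..s, q t * IccExtend hb u t)
        simp only [← intervalIntegral.integral_const_mul]
        refine intervalIntegral.integral_congr fun s hs => ?_
        refine intervalIntegral.integral_congr fun t ht => ?_
        simp [IccExtend]
        ring }
    -- The operator bound is the case n = 0 of `norm_volterraFun_apply_le`.
    (b * ∫ t in (0 : ℝ)..b, ‖q t‖) fun u => by
      have hnn (s : ℝ) (hs : 0 ≤ s) : 0 ≤ ∫ t in (0 : ℝ)..s, ‖q t‖ :=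
        intervalIntegral.integral_nonneg hs fun _ _ => norm_nonneg _
      have := hnn b hb
      rw [ContinuousMap.norm_le _ (by positivity)]
      intro r
      refine (norm_volterraFun_apply_le hb hq u (norm_nonneg u) 0
        (fun r => by simpa using u.norm_coe_le_norm r) r).trans ?_
      have h := intervalIntegral.integral_mono_interval le_rfl r.2.1 r.2.2
        (Eventually.of_forall fun t => norm_nonneg (q t)) hq.norm
      have := hnn r r.2.1
      simp only [CharP.cast_eq_zero, zero_add, div_one, pow_one]
      calc _ ≤ b * ‖u‖ * (∫ t in (0 : ℝ)..b, ‖q t‖) := by gcongr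
        _ = _ := by ring

theorem volterra_apply (hq : IntervalIntegrable q volume 0 b) (u : C(Icc (0 : ℝ) b, ℂ))
    (r : Icc (0 : ℝ) b) : volterra hb hq u r =
      ∫ s in (0 : ℝ)..r, ∫ t in (0 : ℝ)..s, q t * IccExtend hb u t := rfl

theorem norm_volterra_pow_apply_le (hq : IntervalIntegrable q volume 0 b)
    (u : C(Icc (0 : ℝ) b, ℂ)) (n : ℕ) (r : Icc (0 : ℝ) b) :
    ‖(volterra hb hq ^ n) u r‖ ≤
      b ^ n * ‖u‖ / n.factorial * (∫ t in (0 : ℝ)..r, ‖q t‖) ^ n := by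
  induction n generalizing r with
  | zero => simpa using u.norm_coe_le_norm r
  | succ n ih =>
    rw [pow_succ']
    refine (norm_volterraFun_apply_le hb hq ((volterra hb hq ^ n) u) (by positivity) n
      ih r).trans (le_of_eq ?_)
    rw [Nat.factorial_succ]
    push_cast
    field_simp
    ring

theorem isUnit_one_sub_volterra (hq : IntervalIntegrable q volume 0 b) :
    IsUnit (1 - volterra hb hq) := by
  set T := volterra hb hq
  set W := ∫ t in (0 : ℝ)..b, ‖q t‖
  have hW : 0 ≤ W := intervalIntegral.integral_nonneg hb fun _ _ => norm_nonneg _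
  have hT (n : ℕ) : ‖T ^ n‖ ≤ (b * W) ^ n / n.factorial := by
    refine ContinuousLinearMap.opNorm_le_bound _ (by positivity) fun u => ?_
    rw [ContinuousMap.norm_le _ (by positivity)]
    intro r
    refine (norm_volterra_pow_apply_le hb hq u n r).trans ?_
    have h := intervalIntegral.integral_mono_interval le_rfl r.2.1 r.2.2
      (Eventually.of_forall fun t => norm_nonneg (q t)) hq.norm
    have : 0 ≤ ∫ t in (0 : ℝ)..r, ‖q t‖ :=
      intervalIntegral.integral_nonneg r.2.1 fun _ _ => norm_nonneg _
    calc _ ≤ b ^ n * ‖u‖ / n.factorial * W ^ n := by gcongr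
      _ = _ := by rw [mul_pow]; ring
  -- (bW)^n / n! tends to zero, so some power has norm below one.
  obtain ⟨n, hn⟩ := ((FloorSemiring.tendsto_pow_div_factorial_atTop (b * W)).eventually
    (gt_mem_nhds one_pos)).exists
  exact isUnit_one_sub_of_pow T n (Units.oneSub (T ^ n) ((hT n).trans_lt hn)).isUnit

/-- Used with c = k²: the spectral parameter enters the operator polynomially, which makes the
inverse of 1 minus it holomorphic in k. -/
theorem volterra_sub_const (hq : IntervalIntegrable q volume 0 b) (c : ℂ)
    (hqc : IntervalIntegrable (fun s => q s - c) volume 0 b)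
    (h1 : IntervalIntegrable (fun _ => (1 : ℂ)) volume 0 b) :
    volterra hb hqc = volterra hb hq - c • volterra hb h1 := by
  ext u r
  change ∫ s in (0 : ℝ)..r, ∫ t in (0 : ℝ)..s, (q t - c) * IccExtend hb u t =
    (∫ s in (0 : ℝ)..r, ∫ t in (0 : ℝ)..s, q t * IccExtend hb u t) -
      c * ∫ s in (0 : ℝ)..r, ∫ t in (0 : ℝ)..s, 1 * IccExtend hb u t
  rw [← intervalIntegral.integral_const_mul, ← intervalIntegral.integral_sub
    (intervalIntegrable_inner_integral hb hq u r.2)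
    ((intervalIntegrable_inner_integral hb h1 u r.2).const_mul c)]
  refine intervalIntegral.integral_congr fun s hs => ?_
  have hs' : s ∈ uIcc 0 b := by
    rw [uIcc_of_le r.2.1] at hs
    rw [uIcc_of_le hb]
    exact ⟨hs.1, hs.2.trans r.2.2⟩
  rw [← intervalIntegral.integral_const_mul, ← intervalIntegral.integral_sub
    ((intervalIntegrable_mul_IccExtend hb hq u).mono_set (uIcc_subset_uIcc (by simp) hs'))
    (((intervalIntegrable_mul_IccExtend hb h1 u).mono_set
      (uIcc_subset_uIcc (by simp) hs')).const_mul c)]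
  refine intervalIntegral.integral_congr fun t ht => ?_
  ring

/-- The affine function `a₀ + a₁ r` on `[0, b]`. -/
def affineData (b : ℝ) (a₀ a₁ : ℂ) : C(Icc (0 : ℝ) b, ℂ) where
  toFun r := a₀ + a₁ * (r : ℝ)
  continuous_toFun := by fun_prop

/-- The solution on `[0, b]` of `u'' = q u` with `u(0) = a₀`, `u'(0) = a₁`, as a continuous
function. -/
def volterraSolution (hq : IntervalIntegrable q volume 0 b) (a₀ a₁ : ℂ) : C(Icc (0 : ℝ) b, ℂ) :=
  Ring.inverse (1 - volterra hb hq) (affineData b a₀ a₁)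

theorem volterraSolution_eq (hq : IntervalIntegrable q volume 0 b) (a₀ a₁ : ℂ)
    (r : Icc (0 : ℝ) b) : volterraSolution hb hq a₀ a₁ r = a₀ + a₁ * (r : ℝ) +
      ∫ s in (0 : ℝ)..r, ∫ t in (0 : ℝ)..s,
        q t * IccExtend hb (volterraSolution hb hq a₀ a₁) t := by
  have h := Ring.mul_inverse_cancel _ (isUnit_one_sub_volterra hb hq)
  have h2 := congrArg (fun L : C(Icc (0 : ℝ) b, ℂ) →L[ℂ] C(Icc (0 : ℝ) b, ℂ) =>
    L (affineData b a₀ a₁) r) h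
  change volterraSolution hb hq a₀ a₁ r - volterra hb hq (volterraSolution hb hq a₀ a₁) r =
    a₀ + a₁ * (r : ℝ) at h2
  rw [← h2, volterra_apply]
  ring

/-- Injectivity of 1 - T. Uniqueness matters because the eigenfunctions are selected by choice:
whichever irregular eigenfunction was chosen, its reflection must be this solution. -/
theorem eq_volterraSolution (hq : IntervalIntegrable q volume 0 b) (a₀ a₁ : ℂ)
    (u : C(Icc (0 : ℝ) b, ℂ)) (hu : ∀ r : Icc (0 : ℝ) b, u r = a₀ + a₁ * (r : ℝ) +
      ∫ s in (0 : ℝ)..r, ∫ t in (0 : ℝ)..s, q t * IccExtend hb u t) :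
    u = volterraSolution hb hq a₀ a₁ := by
  have h := Ring.inverse_mul_cancel _ (isUnit_one_sub_volterra hb hq)
  have h2 := congrArg (fun L : C(Icc (0 : ℝ) b, ℂ) →L[ℂ] C(Icc (0 : ℝ) b, ℂ) => L u) h
  have h3 : (1 - volterra hb hq) u = affineData b a₀ a₁ := by
    ext r
    change u r - volterra hb hq u r = a₀ + a₁ * (r : ℝ)
    rw [volterra_apply]
    nth_rewrite 1 [hu r]
    ring
  change Ring.inverse (1 - volterra hb hq) ((1 - volterra hb hq) u) = u at h2
  rw [h3] at h2
  exact h2.symm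

end Volterra

/-! ### Existence of the eigenfunctions -/

theorem isSchrodingerSolution_of_integral {V : ℝ → ℝ} {k : ℂ} {u v : ℝ → ℂ}
    (hvc : ContinuousOn v (Ici 0)) (hu : ∀ r, 0 ≤ r → u r = u 0 + ∫ s in (0 : ℝ)..r, v s)
    (hv : ∀ r, 0 ≤ r → v r = v 0 + ∫ s in (0 : ℝ)..r, ((V s : ℂ) - k ^ 2) * u s) :
    IsSchrodingerSolution V k u ∧ ∀ r, 0 ≤ r → radialDeriv u r = v r := by
  -- Freezing `v` to the left of 0 makes it continuous on the whole line, so the two-sided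
  -- fundamental theorem applies even at r = 0.
  have hw : Continuous fun s => v (max s 0) :=
    hvc.comp_continuous (by fun_prop) fun s => mem_Ici.2 (le_max_right _ _)
  have hd (r : ℝ) (hr : 0 ≤ r) : HasDerivWithinAt u (v r) (Ici 0) r := by
    have h1 := ((hw.integral_hasStrictDerivAt 0 r).hasDerivAt.const_add (u 0)).hasDerivWithinAt
      (s := Ici 0)
    rw [max_eq_left hr] at h1
    refine h1.congr_of_mem (fun x hx => ?_) hr
    rw [hu x hx]
    congr 1
    refine intervalIntegral.integral_congr fun s hs => ?_
    rw [uIcc_of_le hx] at hs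
    simp [max_eq_left hs.1]
  have hrd (r : ℝ) (hr : 0 ≤ r) : radialDeriv u r = v r :=
    (hd r hr).derivWithin (uniqueDiffOn_Ici 0 r hr)
  refine ⟨⟨fun r hr => (hd r hr).differentiableWithinAt, fun r hr => ?_⟩, hrd⟩
  rw [hrd r hr, hrd 0 le_rfl, hv r hr]

/-- A solution on `[0, R]` is continued beyond the support of the potential by a solution of the
free equation. -/
theorem exists_solution_of_matching {V : ℝ → ℝ} {R : ℝ} {k : ℂ} (hR : 0 ≤ R)
    (hV : Integrable V) (hV0 : ∀ r, R < r → V r = 0) {u v p p' : ℝ → ℂ}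
    (huc : ContinuousOn u (Icc 0 R)) (hvc : ContinuousOn v (Icc 0 R))
    (hu : ∀ r ∈ Icc 0 R, u r = u 0 + ∫ s in (0 : ℝ)..r, v s)
    (hv : ∀ r ∈ Icc 0 R, v r = v 0 + ∫ s in (0 : ℝ)..r, ((V s : ℂ) - k ^ 2) * u s)
    (hp : ∀ r, HasDerivAt p (p' r) r) (hp' : ∀ r, HasDerivAt p' (-k ^ 2 * p r) r)
    (h0 : p R = u R) (h1 : p' R = v R) :
    ∃ y, IsSchrodingerSolution V k y ∧ (∀ r ∈ Icc 0 R, y r = u r) ∧ (∀ r, R ≤ r → y r = p r) ∧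
      ∀ r ∈ Icc 0 R, radialDeriv y r = v r := by
  classical
  set y : ℝ → ℂ := fun r => if r ≤ R then u r else p r with hy
  set w : ℝ → ℂ := fun r => if r ≤ R then v r else p' r with hw
  have hyu (r : ℝ) (hr : r ≤ R) : y r = u r := if_pos hr
  have hwv (r : ℝ) (hr : r ≤ R) : w r = v r := if_pos hr
  have hyp (r : ℝ) (hr : R ≤ r) : y r = p r := by
    rcases hr.eq_or_lt with rfl | h
    · rw [hyu _ le_rfl, h0]
    · exact if_neg h.not_ge
  have hwp (r : ℝ) (hr : R ≤ r) : w r = p' r := by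
    rcases hr.eq_or_lt with rfl | h
    · rw [hwv _ le_rfl, h1]
    · exact if_neg h.not_ge
  have hpc : Continuous p := continuous_iff_continuousAt.2 fun r => (hp r).continuousAt
  have hpc' : Continuous p' := continuous_iff_continuousAt.2 fun r => (hp' r).continuousAt
  have hunion : Icc 0 R ∪ Ici R = Ici (0 : ℝ) := Icc_union_Ici_eq_Ici hR
  have hyc : ContinuousOn y (Ici 0) := by
    rw [← hunion]
    exact (huc.congr fun r hr => hyu r hr.2).union_of_isClosed
      (hpc.continuousOn.congr fun r hr => hyp r hr) isClosed_Icc isClosed_Ici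
  have hwc : ContinuousOn w (Ici 0) := by
    rw [← hunion]
    exact (hvc.congr fun r hr => hwv r hr.2).union_of_isClosed
      (hpc'.continuousOn.congr fun r hr => hwp r hr) isClosed_Icc isClosed_Ici
  have hsub (a b : ℝ) (ha : 0 ≤ a) (hb : 0 ≤ b) : uIcc a b ⊆ Ici 0 := fun x hx =>
    le_trans (le_inf ha hb) hx.1
  have hiw (a b : ℝ) (ha : 0 ≤ a) (hb : 0 ≤ b) : IntervalIntegrable w volume a b :=
    (hwc.mono (hsub a b ha hb)).intervalIntegrable
  have hiy (a b : ℝ) (ha : 0 ≤ a) (hb : 0 ≤ b) :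
      IntervalIntegrable (fun s => ((V s : ℂ) - k ^ 2) * y s) volume a b :=
    ((hV.ofReal.intervalIntegrable).sub intervalIntegrable_const).mul_continuousOn
      (hyc.mono (hsub a b ha hb))
  have hint {g g' : ℝ → ℂ} {r : ℝ} (hr : r ∈ Icc 0 R) (h : ∀ s, s ≤ R → g s = g' s) :
      ∫ s in (0 : ℝ)..r, g s = ∫ s in (0 : ℝ)..r, g' s := by
    refine intervalIntegral.integral_congr fun s hs => ?_
    rw [uIcc_of_le hr.1] at hs
    exact h s (hs.2.trans hr.2)
  have key := isSchrodingerSolution_of_integral (V := V) (k := k) hwc (u := y) (fun r hr => ?_)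
    fun r hr => ?_
  · exact ⟨y, key.1, fun r hr => hyu r hr.2, hyp, fun r hr => by rw [key.2 r hr.1, hwv r hr.2]⟩
  · have hin (r : ℝ) (hr : r ∈ Icc 0 R) : y r = y 0 + ∫ s in (0 : ℝ)..r, w s := by
      rw [hint hr hwv, hyu r hr.2, hyu 0 hR]
      exact hu r hr
    rcases le_total r R with h | h
    · exact hin r ⟨hr, h⟩
    · rw [← intervalIntegral.integral_add_adjacent_intervals (hiw 0 R le_rfl hR) (hiw R r hR hr),
        ← add_assoc, ← hin R ⟨hR, le_rfl⟩]
      have : ∫ s in R..r, w s = p r - p R := by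
        rw [← intervalIntegral.integral_eq_sub_of_hasDerivAt (fun s _ => hp s)
          (hpc'.intervalIntegrable _ _)]
        refine intervalIntegral.integral_congr fun s hs => ?_
        rw [uIcc_of_le h] at hs
        exact hwp s hs.1
      rw [this, hyp r h, hyp R le_rfl]
      ring
  · have hin (r : ℝ) (hr : r ∈ Icc 0 R) :
        w r = w 0 + ∫ s in (0 : ℝ)..r, ((V s : ℂ) - k ^ 2) * y s := by
      rw [hint (g' := fun s => ((V s : ℂ) - k ^ 2) * u s) hr fun s hs => by rw [hyu s hs],
        hwv r hr.2, hwv 0 hR]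
      exact hv r hr
    rcases le_total r R with h | h
    · exact hin r ⟨hr, h⟩
    · rw [← intervalIntegral.integral_add_adjacent_intervals (hiy 0 R le_rfl hR) (hiy R r hR hr),
        ← add_assoc, ← hin R ⟨hR, le_rfl⟩]
      have : ∫ s in R..r, ((V s : ℂ) - k ^ 2) * y s = p' r - p' R := by
        rw [← intervalIntegral.integral_eq_sub_of_hasDerivAt (fun s _ => hp' s)
          ((by fun_prop : Continuous fun s => -k ^ 2 * p s).intervalIntegrable _ _)]
        refine intervalIntegral.integral_congr_ae (Eventually.of_forall fun s hs => ?_)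
        rw [uIoc_of_le h] at hs
        simp [hV0 s hs.1, hyp s hs.1.le]
      rw [this, hwp r h, hwp R le_rfl]
      ring

section

variable {b : ℝ} (hb : 0 ≤ b) {q : ℝ → ℂ}

/-- The derivative of `volterraSolution`. -/
def volterraSolutionDeriv (hq : IntervalIntegrable q volume 0 b) (a₀ a₁ : ℂ) (r : ℝ) : ℂ :=
  a₁ + ∫ t in (0 : ℝ)..r, q t * IccExtend hb (volterraSolution hb hq a₀ a₁) t

theorem continuousOn_volterraSolutionDeriv (hq : IntervalIntegrable q volume 0 b) (a₀ a₁ : ℂ) :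
    ContinuousOn (volterraSolutionDeriv hb hq a₀ a₁) (Icc 0 b) :=
  continuousOn_const.add (continuousOn_inner_integral hb hq _)

theorem volterraSolution_zero (hq : IntervalIntegrable q volume 0 b) (a₀ a₁ : ℂ) :
    IccExtend hb (volterraSolution hb hq a₀ a₁) 0 = a₀ := by
  rw [IccExtend_of_mem hb _ (left_mem_Icc.2 hb), volterraSolution_eq]
  simp

theorem volterraSolution_eq_integral (hq : IntervalIntegrable q volume 0 b) (a₀ a₁ : ℂ)
    {r : ℝ} (hr : r ∈ Icc 0 b) : IccExtend hb (volterraSolution hb hq a₀ a₁) r =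
      a₀ + ∫ s in (0 : ℝ)..r, volterraSolutionDeriv hb hq a₀ a₁ s := by
  rw [IccExtend_of_mem hb _ hr, volterraSolution_eq]
  simp only [volterraSolutionDeriv]
  rw [intervalIntegral.integral_add intervalIntegrable_const
    (intervalIntegrable_inner_integral hb hq _ hr)]
  simp only [intervalIntegral.integral_const, sub_zero, Complex.real_smul]
  ring

end

/-- The free equation `p'' = -k² p` has solutions with arbitrary data at `R`. -/
theorem exists_free_solution (k : ℂ) (R : ℝ) (a₀ a₁ : ℂ) : ∃ p p' : ℝ → ℂ,
    (∀ r, HasDerivAt p (p' r) r) ∧ (∀ r, HasDerivAt p' (-k ^ 2 * p r) r) ∧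
      p R = a₀ ∧ p' R = a₁ := by
  have hid (r : ℝ) : HasDerivAt (fun r : ℝ => ((r - R : ℝ) : ℂ)) 1 r := by
    simpa using ((hasDerivAt_id r).sub_const R).ofReal_comp
  -- At k = 0 the solution a₁ sin(k(r - R))/k degenerates and is replaced by its limit, an affine
  -- function.
  rcases eq_or_ne k 0 with rfl | hk
  · refine ⟨fun r => a₀ + a₁ * ((r - R : ℝ) : ℂ), fun _ => a₁, fun r => ?_, fun r => ?_, by simp,
      rfl⟩
    · simpa using ((hid r).const_mul a₁).const_add a₀
    · simpa using hasDerivAt_const r a₁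
  · have hc (r : ℝ) : HasDerivAt (fun r : ℝ => Complex.cos (k * ((r - R : ℝ) : ℂ)))
        (-Complex.sin (k * ((r - R : ℝ) : ℂ)) * k) r := by
      simpa using! (Complex.hasDerivAt_cos _).comp r ((hid r).const_mul k)
    have hs (r : ℝ) : HasDerivAt (fun r : ℝ => Complex.sin (k * ((r - R : ℝ) : ℂ)))
        (Complex.cos (k * ((r - R : ℝ) : ℂ)) * k) r := by
      simpa using! (Complex.hasDerivAt_sin _).comp r ((hid r).const_mul k)
    refine ⟨fun r => a₀ * Complex.cos (k * ((r - R : ℝ) : ℂ)) +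
        a₁ / k * Complex.sin (k * ((r - R : ℝ) : ℂ)),
      fun r => a₀ * (-Complex.sin (k * ((r - R : ℝ) : ℂ)) * k) +
        a₁ / k * (Complex.cos (k * ((r - R : ℝ) : ℂ)) * k), fun r => ?_, fun r => ?_, by simp,
      by simp [hk]⟩
    · exact ((hc r).const_mul a₀).add ((hs r).const_mul (a₁ / k))
    · exact (((((hs r).neg).mul_const k).const_mul a₀).add
        (((hc r).mul_const k).const_mul (a₁ / k))).congr_deriv (by ring)

theorem exists_regularEigenfunction {V : ℝ → ℝ} {R : ℝ} (k : ℂ) (hR : 0 ≤ R)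
    (hV : Integrable V) (hV0 : ∀ r, R < r → V r = 0) : ∃ u, IsRegularEigenfunction V k u := by
  have hq : IntervalIntegrable (fun s => (V s : ℂ) - k ^ 2) volume 0 R :=
    hV.ofReal.intervalIntegrable.sub intervalIntegrable_const
  obtain ⟨p, p', hp, hp', h0, h1⟩ := exists_free_solution k R
    (IccExtend hR (volterraSolution hR hq 0 1) R) (volterraSolutionDeriv hR hq 0 1 R)
  obtain ⟨y, hy, hy1, -, hy2⟩ := exists_solution_of_matching hR hV hV0
    (volterraSolution hR hq 0 1).continuous.Icc_extend'.continuousOn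
    (continuousOn_volterraSolutionDeriv hR hq 0 1)
    (fun r hr => by rw [volterraSolution_zero, volterraSolution_eq_integral hR hq _ _ hr])
    (fun r hr => by simp [volterraSolutionDeriv]) hp hp' h0 h1
  have hmem : (0 : ℝ) ∈ Icc 0 R := left_mem_Icc.2 hR
  exact ⟨y, hy, by rw [hy1 0 hmem, volterraSolution_zero],
    by rw [hy2 0 hmem, volterraSolutionDeriv]; simp⟩

/-- Reflection r ↦ R - r turns the condition at R into initial data at 0, so the same Volterra
operator produces the irregular eigenfunction. -/
theorem intervalIntegrable_reflected {V : ℝ → ℝ} (hV : Integrable V) (R : ℝ) :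
    IntervalIntegrable (fun s => ((V (R - s) : ℝ) : ℂ)) volume 0 R :=
  (hV.comp_sub_left R).ofReal.intervalIntegrable

theorem intervalIntegrable_reflected_sub {V : ℝ → ℝ} (hV : Integrable V) (R : ℝ) (k : ℂ) :
    IntervalIntegrable (fun s => ((V (R - s) : ℝ) : ℂ) - k ^ 2) volume 0 R :=
  (intervalIntegrable_reflected hV R).sub intervalIntegrable_const

theorem hasDerivAt_exp_mul (c : ℂ) (r : ℝ) :
    HasDerivAt (fun r : ℝ => Complex.exp (c * r)) (c * Complex.exp (c * r)) r := by
  have := ((hasDerivAt_id r).ofReal_comp.const_mul c).cexp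
  simpa [mul_comm] using this

theorem exists_irregularEigenfunction {V : ℝ → ℝ} {R : ℝ} (k : ℂ) (hR : 0 ≤ R)
    (hV : Integrable V) (hV0 : ∀ r, R < r → V r = 0) :
    ∃ u, IsIrregularEigenfunction V R k u := by
  have hq := intervalIntegrable_reflected_sub hV R k
  set a₀ := Complex.exp (Complex.I * k * R)
  -- The reflection reverses the sign of the derivative.
  set a₁ := -(Complex.I * k * Complex.exp (Complex.I * k * R)) with ha₁
  set h := IccExtend hR (volterraSolution hR hq a₀ a₁) with hh
  set H := volterraSolutionDeriv hR hq a₀ a₁ with hH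
  have hhc : Continuous h := (volterraSolution hR hq a₀ a₁).continuous.Icc_extend'
  have hHc : ContinuousOn H (Icc 0 R) := continuousOn_volterraSolutionDeriv hR hq a₀ a₁
  have hmaps : MapsTo (fun r : ℝ => R - r) (Icc 0 R) (Icc 0 R) := fun r hr =>
    ⟨by linarith [hr.2], by linarith [hr.1]⟩
  have hHi (x y : ℝ) (hx : x ∈ Icc 0 R) (hy : y ∈ Icc 0 R) : IntervalIntegrable H volume x y :=
    (hHc.mono (uIcc_subset_Icc hx hy)).intervalIntegrable
  have hqi (x y : ℝ) (hx : x ∈ Icc 0 R) (hy : y ∈ Icc 0 R) :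
      IntervalIntegrable (fun s => (((V (R - s) : ℝ) : ℂ) - k ^ 2) * h s) volume x y :=
    (hq.mul_continuousOn hhc.continuousOn).mono_set (by
      rw [uIcc_of_le hR]
      exact uIcc_subset_Icc hx hy)
  have hl : (0 : ℝ) ∈ Icc 0 R := left_mem_Icc.2 hR
  have hr' : R ∈ Icc 0 R := right_mem_Icc.2 hR
  obtain ⟨y, hy, -, hy1, -⟩ := exists_solution_of_matching (k := k) hR hV hV0
    (u := fun r => h (R - r)) (v := fun r => -H (R - r))
    (p := fun r => Complex.exp (Complex.I * k * r))
    (p' := fun r => Complex.I * k * Complex.exp (Complex.I * k * r))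
    (by fun_prop) (hHc.comp (by fun_prop) hmaps).neg
    (fun r hr => by
      have e := intervalIntegral.integral_interval_sub_left (hHi 0 R hl hr')
        (hHi 0 (R - r) hl (hmaps hr))
      rw [intervalIntegral.integral_neg, intervalIntegral.integral_comp_sub_left H, sub_zero, ← e,
        hh, volterraSolution_eq_integral hR hq _ _ (hmaps hr),
        volterraSolution_eq_integral hR hq _ _ hr']
      ring)
    (fun r hr => by
      have e := intervalIntegral.integral_interval_sub_left (hqi 0 R hl hr')
        (hqi 0 (R - r) hl (hmaps hr))
      have e2 := intervalIntegral.integral_comp_sub_left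
        (a := 0) (b := r) (fun s => (((V (R - s) : ℝ) : ℂ) - k ^ 2) * h s) R
      simp only [sub_sub_cancel, sub_zero] at e2
      rw [e2, ← e, sub_zero]
      simp only [hH, volterraSolutionDeriv]
      ring)
    (hasDerivAt_exp_mul _)
    (fun r => by
      refine ((hasDerivAt_exp_mul (Complex.I * k) r).const_mul (Complex.I * k)).congr_deriv ?_
      linear_combination (k ^ 2 * Complex.exp (Complex.I * k * r)) * Complex.I_sq)
    (by rw [sub_self, hh, volterraSolution_zero])
    (by simp [hH, volterraSolutionDeriv, a₁])
  exact ⟨y, hy, hy1⟩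

/-! ### The Jost function is entire -/

theorem IsSchrodingerSolution.hasDerivWithinAt {V : ℝ → ℝ} {k : ℂ} {u : ℝ → ℂ}
    (hu : IsSchrodingerSolution V k u) {r : ℝ} (hr : 0 ≤ r) :
    HasDerivWithinAt u (radialDeriv u r) (Ici 0) r :=
  (hu.differentiableOn r hr).hasDerivWithinAt

theorem IsSchrodingerSolution.continuousOn_radialDeriv {V : ℝ → ℝ} {k : ℂ} {u : ℝ → ℂ}
    (hV : Integrable V) (hu : IsSchrodingerSolution V k u) {b : ℝ} (hb : 0 ≤ b) :
    ContinuousOn (radialDeriv u) (Icc 0 b) := by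
  have := (hu.deriv_absolutelyContinuous hV hb).continuousOn
  rwa [uIcc_of_le hb] at this

theorem IsSchrodingerSolution.eq_add_integral {V : ℝ → ℝ} {k : ℂ} {u : ℝ → ℂ}
    (hV : Integrable V) (hu : IsSchrodingerSolution V k u) {r : ℝ} (hr : 0 ≤ r) :
    u r = u 0 + ∫ s in (0 : ℝ)..r, radialDeriv u s := by
  have hc := hu.continuousOn_radialDeriv hV hr
  refine eq_add_integral_of_absolutelyContinuous (hu.absolutelyContinuous hV hr)
    (by rw [← uIcc_of_le hr] at hc; exact hc.intervalIntegrable) ?_ right_mem_uIcc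
  filter_upwards [hu.ae_hasDerivAt hV hr] with s hs h using (hs h).1

/-- The derivative within `Ici 0` restricts to `Ici R`, where the function is an explicit
exponential, and one-sided derivatives are unique. -/
theorem IsIrregularEigenfunction.radialDeriv_eq {V : ℝ → ℝ} {R : ℝ} {k : ℂ} {u : ℝ → ℂ}
    (hR : 0 ≤ R) (hu : IsIrregularEigenfunction V R k u) :
    radialDeriv u R = Complex.I * k * Complex.exp (Complex.I * k * R) := by
  have h1 := (hu.isSolution.hasDerivWithinAt hR).mono (Ici_subset_Ici.2 hR)
  have h2 : HasDerivWithinAt u (Complex.I * k * Complex.exp (Complex.I * k * R)) (Ici R) R :=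
    (hasDerivAt_exp_mul (Complex.I * k) R).hasDerivWithinAt.congr (fun r hr => hu.eq_exp r hr)
      (hu.eq_exp R le_rfl)
  exact (uniqueDiffOn_Ici R R self_mem_Ici).eq_deriv _ h1 h2

/-- The reflected irregular eigenfunction solves a Volterra equation, which determines its value
at the origin. -/
theorem IsIrregularEigenfunction.apply_zero {V : ℝ → ℝ} {R : ℝ} {k : ℂ} {u : ℝ → ℂ}
    (hR : 0 ≤ R) (hV : Integrable V) (hu : IsIrregularEigenfunction V R k u) :
    u 0 = volterraSolution hR (intervalIntegrable_reflected_sub hV R k)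
      (Complex.exp (Complex.I * k * R)) (-(Complex.I * k * Complex.exp (Complex.I * k * R)))
      ⟨R, right_mem_Icc.2 hR⟩ := by
  have hs := hu.isSolution
  have hmaps : MapsTo (fun r : ℝ => R - r) (Icc 0 R) (Icc 0 R) := fun r hr =>
    ⟨by linarith [hr.2], by linarith [hr.1]⟩
  have hc : ContinuousOn (fun r => u (R - r)) (Icc 0 R) :=
    (hs.differentiableOn.continuousOn.mono Icc_subset_Ici_self).comp (by fun_prop) hmaps
  set h : C(Icc (0 : ℝ) R, ℂ) := ⟨fun r => u (R - r), continuousOn_iff_continuous_domRestrict.1 hc⟩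
  have hq := intervalIntegrable_reflected_sub hV R k
  have key := eq_volterraSolution hR hq (Complex.exp (Complex.I * k * R))
    (-(Complex.I * k * Complex.exp (Complex.I * k * R))) h (fun r => ?_)
  · rw [← key]
    change u 0 = u (R - R)
    rw [sub_self]
  · obtain ⟨r, hr⟩ := r
    have hl : (0 : ℝ) ∈ Icc 0 R := left_mem_Icc.2 hR
    have hr' : R ∈ Icc 0 R := right_mem_Icc.2 hR
    have hd := hs.continuousOn_radialDeriv hV hR
    have hdi (x y : ℝ) (hx : x ∈ Icc 0 R) (hy : y ∈ Icc 0 R) :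
        IntervalIntegrable (radialDeriv u) volume x y :=
      (hd.mono (uIcc_subset_Icc hx hy)).intervalIntegrable
    have hqi (x y : ℝ) (hx : x ∈ Icc 0 R) (hy : y ∈ Icc 0 R) :
        IntervalIntegrable (fun s => ((V s : ℂ) - k ^ 2) * u s) volume x y :=
      (hs.intervalIntegrable hV hR).mono_set (by
        rw [uIcc_of_le hR]
        exact uIcc_subset_Icc hx hy)
    have hinner (s : ℝ) (hsm : s ∈ Icc 0 R) :
        ∫ t in (0 : ℝ)..s, (((V (R - t) : ℝ) : ℂ) - k ^ 2) * IccExtend hR h t =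
          radialDeriv u R - radialDeriv u (R - s) := by
      rw [hs.radialDeriv_eq R hR, hs.radialDeriv_eq (R - s) (hmaps hsm).1, add_sub_add_left_eq_sub,
        intervalIntegral.integral_interval_sub_left (hqi 0 R hl hr') (hqi 0 _ hl (hmaps hsm))]
      have e2 := intervalIntegral.integral_comp_sub_left
        (a := 0) (b := s) (fun s => ((V s : ℂ) - k ^ 2) * u s) R
      rw [sub_zero] at e2
      rw [← e2]
      refine intervalIntegral.integral_congr fun t ht => ?_
      rw [uIcc_of_le hsm.1] at ht
      simp only [IccExtend_of_mem hR h ⟨ht.1, ht.2.trans hsm.2⟩]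
      rfl
    have houter : ∫ s in (0 : ℝ)..r, ∫ t in (0 : ℝ)..s,
          (((V (R - t) : ℝ) : ℂ) - k ^ 2) * IccExtend hR h t =
        ∫ s in (0 : ℝ)..r, (radialDeriv u R - radialDeriv u (R - s)) := by
      refine intervalIntegral.integral_congr fun s hsm => ?_
      rw [uIcc_of_le hr.1] at hsm
      exact hinner s ⟨hsm.1, hsm.2.trans hr.2⟩
    have hdr : IntervalIntegrable (fun s => radialDeriv u (R - s)) volume 0 r := by
      refine ContinuousOn.intervalIntegrable ((hd.comp (by fun_prop) hmaps).mono ?_)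
      exact uIcc_subset_Icc hl hr
    change u (R - r) = _
    rw [houter, intervalIntegral.integral_sub intervalIntegrable_const hdr,
      intervalIntegral.integral_comp_sub_left (radialDeriv u), sub_zero,
      ← intervalIntegral.integral_interval_sub_left (hdi 0 R hl hr') (hdi 0 _ hl (hmaps hr)),
      hu.radialDeriv_eq hR]
    have e1 := hs.eq_add_integral hV hR
    have e2 := hs.eq_add_integral hV (hmaps hr).1
    rw [hu.eq_exp R le_rfl] at e1
    simp only [intervalIntegral.integral_const, sub_zero, Complex.real_smul]
    linear_combination e2 - e1

theorem differentiableAt_inverse_one_sub {A : Type*} [NormedRing A] [NormedAlgebra ℂ A]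
    [HasSummableGeomSeries A] (T S : A) {k : ℂ} (h : IsUnit (1 - (T - k ^ 2 • S))) :
    DifferentiableAt ℂ (fun k : ℂ => Ring.inverse (1 - (T - k ^ 2 • S))) k := by
  exact DifferentiableAt.comp (f := fun k : ℂ => 1 - (T - k ^ 2 • S)) k
    (differentiableAt_inverse (𝕜 := ℂ) h) (by fun_prop)

theorem irregularEigenfunction_spec {V : ℝ → ℝ} {R : ℝ} (hR : 0 ≤ R)
    (hV : Integrable V) (hV0 : ∀ r, R < r → V r = 0) (k : ℂ) :
    IsIrregularEigenfunction V R k (irregularEigenfunction V R k) :=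
  Classical.epsilon_spec (exists_irregularEigenfunction k hR hV hV0)

theorem jostFunction_eq {V : ℝ → ℝ} {R : ℝ} (hR : 0 ≤ R)
    (hV : Integrable V) (hV0 : ∀ r, R < r → V r = 0) (k : ℂ) :
    jostFunction V R k = irregularEigenfunction V R k 0 := by
  have h : IsRegularEigenfunction V k (regularEigenfunction V k) :=
    Classical.epsilon_spec (exists_regularEigenfunction k hR hV hV0)
  rw [jostFunction, wronskian, h.value_zero, h.deriv_zero]
  ring

/-- F(k) is the value at the end point R of (1 - (T - k²S))⁻¹ applied to data entire in k. Inversion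
is holomorphic on units, and point evaluation is a bounded functional. -/
theorem differentiable_jostFunction {V : ℝ → ℝ} {R : ℝ} (hR : 0 ≤ R)
    (hV : Integrable V) (hV0 : ∀ r, R < r → V r = 0) :
    Differentiable ℂ (jostFunction V R) := by
  have h1 : IntervalIntegrable (fun _ : ℝ => (1 : ℂ)) volume 0 R := intervalIntegrable_const
  set T := volterra hR (intervalIntegrable_reflected hV R)
  set S := volterra hR h1
  have e : jostFunction V R = fun k => (Ring.inverse (1 - (T - k ^ 2 • S))
      (Complex.exp (Complex.I * k * R) • affineData R 1 0 +
        (-(Complex.I * k * Complex.exp (Complex.I * k * R))) • affineData R 0 1))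
      ⟨R, right_mem_Icc.2 hR⟩ := by
    ext k
    rw [jostFunction_eq hR hV hV0,
      (irregularEigenfunction_spec hR hV hV0 k).apply_zero hR hV, volterraSolution,
      volterra_sub_const hR (intervalIntegrable_reflected hV R) (k ^ 2)
        (intervalIntegrable_reflected_sub hV R k) h1]
    congr 2
    ext r
    simp [affineData]
  rw [e]
  intro k
  have hu : IsUnit (1 - (T - k ^ 2 • S)) := by
    rw [← volterra_sub_const hR (intervalIntegrable_reflected hV R) (k ^ 2)
        (intervalIntegrable_reflected_sub hV R k) h1]
    exact isUnit_one_sub_volterra hR _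
  have hd : DifferentiableAt ℂ (fun k : ℂ => Ring.inverse (1 - (T - k ^ 2 • S))) k :=
    differentiableAt_inverse_one_sub T S hu
  have hd2 : DifferentiableAt ℂ (fun k : ℂ => Complex.exp (Complex.I * k * R) • affineData R 1 0 +
        (-(Complex.I * k * Complex.exp (Complex.I * k * R))) • affineData R 0 1) k := by
    fun_prop
  exact (ContinuousMap.evalCLM ℂ (⟨R, right_mem_Icc.2 hR⟩ : Icc (0 : ℝ) R)).differentiableAt.comp k
    (hd.clm_apply hd2)

/-! ### Bounds for the Jost function -/

/-- An absorption argument instead of Gronwall: at a maximum point of `m`, the integral term is at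
most half of that maximum. -/
theorem le_two_mul_of_le_add_integral {V m : ℝ → ℝ} {R a ε : ℝ} (hR : 0 ≤ R)
    (hV : Integrable V) (hmc : ContinuousOn m (Icc 0 R)) (hm0 : ∀ r ∈ Icc 0 R, 0 ≤ m r)
    (hε : 0 ≤ ε) (hεV : ε * ∫ s, |V s| ≤ 1 / 2)
    (hm : ∀ r ∈ Icc 0 R, m r ≤ a + ε * ∫ s in r..R, |V s| * m s) :
    ∀ r ∈ Icc 0 R, m r ≤ 2 * a := by
  obtain ⟨x, hx, hmax⟩ := isCompact_Icc.exists_isMaxOn (nonempty_Icc.2 hR) hmc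
  have h1 : ∫ s in x..R, |V s| * m s ≤ (∫ s, |V s|) * m x := by
    have hsub : uIcc x R ⊆ Icc 0 R := uIcc_subset_Icc hx (right_mem_Icc.2 hR)
    calc ∫ s in x..R, |V s| * m s ≤ ∫ s in x..R, |V s| * m x := by
          refine intervalIntegral.integral_mono_on hx.2
            (hV.abs.intervalIntegrable.mul_continuousOn (hmc.mono hsub))
            (hV.abs.intervalIntegrable.mul_const _) fun s hs => ?_
          exact mul_le_mul_of_nonneg_left (hmax ⟨hx.1.trans hs.1, hs.2⟩) (abs_nonneg _)
      _ = (∫ s in x..R, |V s|) * m x := intervalIntegral.integral_mul_const _ _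
      _ ≤ _ := by
          refine mul_le_mul_of_nonneg_right ?_ (hm0 x hx)
          rw [intervalIntegral.integral_of_le hx.2]
          exact setIntegral_le_integral hV.abs (Eventually.of_forall fun _ => abs_nonneg _)
  intro r hr
  have h2 := hm x hx
  have h3 := mul_le_mul_of_nonneg_left h1 hε
  have h4 := mul_le_mul_of_nonneg_right hεV (hm0 x hx)
  have h5 : m r ≤ m x := hmax hr
  nlinarith

/-- For c² = -k² the equation factors as (∂ - c)(∂ + c)u = Vu, and e^{-cr} is the integrating factor
of the outer operator. -/
theorem IsSchrodingerSolution.exp_mul_eq {V : ℝ → ℝ} {k c : ℂ} {u : ℝ → ℂ} {R : ℝ} (hR : 0 ≤ R)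
    (hV : Integrable V) (hu : IsSchrodingerSolution V k u) (hc : c ^ 2 = -k ^ 2) {r : ℝ}
    (hr : r ∈ Icc 0 R) :
    Complex.exp (-c * R) * (radialDeriv u R + c * u R) -
        Complex.exp (-c * r) * (radialDeriv u r + c * u r) =
      ∫ s in r..R, Complex.exp (-c * s) * (V s * u s) := by
  have hexp : AbsolutelyContinuousOnInterval (fun r : ℝ => Complex.exp (-c * r)) 0 R :=
    (contDiff_const.mul Complex.ofRealCLM.contDiff).cexp.contDiffOn.absolutelyContinuousOnInterval
  have hac : AbsolutelyContinuousOnInterval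
      (fun r => Complex.exp (-c * r) * (radialDeriv u r + c * u r)) 0 R :=
    hexp.smul ((hu.deriv_absolutelyContinuous hV hR).add
      ((hu.absolutelyContinuous hV hR).const_smul c))
  have hcont : ContinuousOn u (uIcc 0 R) := (hu.absolutelyContinuous hV hR).continuousOn
  have hint : IntervalIntegrable (fun s => Complex.exp (-c * s) * (V s * u s)) volume 0 R :=
    (hV.ofReal.intervalIntegrable.mul_continuousOn hcont).continuousOn_mul
      (by fun_prop)
  have hder : ∀ᵐ x, x ∈ uIcc 0 R → HasDerivAt
      (fun r : ℝ => Complex.exp (-c * r) * (radialDeriv u r + c * u r))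
        (Complex.exp (-c * x) * (V x * u x)) x := by
    filter_upwards [hu.ae_hasDerivAt hV hR] with x hx hm
    obtain ⟨h1, h2⟩ := hx hm
    have h3 : HasDerivAt (fun y => radialDeriv u y + c * u y) _ x := h2.add (h1.const_mul c)
    refine ((hasDerivAt_exp_mul (-c) x).mul h3).congr_deriv ?_
    linear_combination (-Complex.exp (-c * x) * u x) * hc
  have hr' : r ∈ uIcc 0 R := by rwa [uIcc_of_le hR]
  have e1 := eq_add_integral_of_absolutelyContinuous hac hint hder hr'
  have e2 := eq_add_integral_of_absolutelyContinuous hac hint hder right_mem_uIcc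
  rw [e1, e2, ← intervalIntegral.integral_interval_sub_left hint
    (hint.mono_set (uIcc_subset_uIcc left_mem_uIcc hr'))]
  ring

theorem IsIrregularEigenfunction.continuousOn_exp_mul {V : ℝ → ℝ} {R : ℝ} {k : ℂ} {u : ℝ → ℂ}
    (hu : IsIrregularEigenfunction V R k u) :
    ContinuousOn (fun r : ℝ => Complex.exp (-(Complex.I * k) * r) * u r) (Icc 0 R) :=
  ContinuousOn.mul (by fun_prop)
    (hu.isSolution.differentiableOn.continuousOn.mono Icc_subset_Ici_self)

/-- The Volterra equation of the normalized irregular eigenfunction `e^{-ikr} f(k, r)`. -/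
theorem IsIrregularEigenfunction.volterra_eq {V : ℝ → ℝ} {R : ℝ} {k : ℂ} {u : ℝ → ℂ} (hR : 0 ≤ R)
    (hV : Integrable V) (hu : IsIrregularEigenfunction V R k u) {r : ℝ} (hr : r ∈ Icc 0 R) :
    2 * Complex.I * k * (Complex.exp (-(Complex.I * k) * r) * u r) =
      2 * Complex.I * k + ∫ s in r..R, (Complex.exp (2 * Complex.I * k * (s - r)) - 1) *
        (V s * (Complex.exp (-(Complex.I * k) * s) * u s)) := by
  have hs := hu.isSolution
  have hsq : (Complex.I * k) ^ 2 = -k ^ 2 := by rw [mul_pow, Complex.I_sq]; ring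
  -- The choices c = ±ik give two first-order relations whose difference eliminates u'. Their
  -- boundary terms at R are 2ik and 0.
  have hQ := hs.exp_mul_eq hR hV hsq hr
  have hP := hs.exp_mul_eq hR hV (c := -(Complex.I * k)) (by rw [neg_sq, hsq]) hr
  rw [hu.radialDeriv_eq hR, hu.eq_exp R le_rfl] at hQ hP
  have hcont : ContinuousOn u (uIcc r R) :=
    hs.differentiableOn.continuousOn.mono fun x hx => by
      rw [uIcc_of_le hr.2] at hx
      exact hr.1.trans hx.1
  have hint (c : ℂ) :
      IntervalIntegrable (fun s => Complex.exp (-c * s) * (V s * u s)) volume r R :=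
    (hV.ofReal.intervalIntegrable.mul_continuousOn hcont).continuousOn_mul (by fun_prop)
  have e : ∫ s in r..R, (Complex.exp (2 * Complex.I * k * (s - r)) - 1) *
        (V s * (Complex.exp (-(Complex.I * k) * s) * u s)) =
      Complex.exp (-(2 * Complex.I * k * r)) *
        (∫ s in r..R, Complex.exp (-(-(Complex.I * k)) * s) * (V s * u s)) -
      ∫ s in r..R, Complex.exp (-(Complex.I * k) * s) * (V s * u s) := by
    rw [← intervalIntegral.integral_const_mul, ← intervalIntegral.integral_sub
      ((hint _).const_mul _) (hint _)]
    refine intervalIntegral.integral_congr fun s _ => ?_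
    have : Complex.exp (2 * Complex.I * k * (s - r)) * Complex.exp (-(Complex.I * k) * s) =
        Complex.exp (-(2 * Complex.I * k * r)) * Complex.exp (-(-(Complex.I * k)) * s) := by
      rw [← Complex.exp_add, ← Complex.exp_add]
      ring_nf
    linear_combination (V s * u s) * this
  rw [e, ← hQ, ← hP]
  have h1 : Complex.exp (-(Complex.I * k) * R) * Complex.exp (Complex.I * k * R) = 1 := by
    rw [← Complex.exp_add]
    simp
  have h2 : Complex.exp (-(2 * Complex.I * k * r)) * Complex.exp (-(-(Complex.I * k)) * r) =
      Complex.exp (-(Complex.I * k) * r) := by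
    rw [← Complex.exp_add]
    ring_nf
  linear_combination (2 * Complex.I * k) * h1 +
    ((radialDeriv u r - Complex.I * k * u r)) * h2

theorem norm_exp_two_mul_I_mul_le {k : ℂ} {τ t : ℝ} (hτ : -k.im ≤ τ) (ht : 0 ≤ t) :
    ‖Complex.exp (2 * Complex.I * k * t)‖ ≤ Real.exp (2 * τ * t) := by
  rw [Complex.norm_exp]
  simp only [Complex.mul_re, Complex.mul_im, Complex.re_ofNat, Complex.im_ofNat, Complex.I_re,
    Complex.I_im, Complex.ofReal_re, Complex.ofReal_im, Real.exp_le_exp]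
  nlinarith

/-- The kernel e^{2ik(s-r)} - 1 is at most 2e^{2τ(s-r)} in norm, and the weight e^{2τr} absorbs this
exponential exactly. What remains is the absorption inequality with ε = 1/|k|. Taking τ = |k| gives
global growth; τ = 0 gives boundedness in the closed upper half plane. -/
theorem IsIrregularEigenfunction.norm_exp_mul_le {V : ℝ → ℝ} {R : ℝ} {k : ℂ} {u : ℝ → ℂ}
    (hR : 0 ≤ R) (hV : Integrable V) (hu : IsIrregularEigenfunction V R k u) {τ : ℝ} (hτ0 : 0 ≤ τ)
    (hτ : -k.im ≤ τ) (hk0 : 0 < ‖k‖) (hk : 2 * ∫ s, |V s| ≤ ‖k‖) {r : ℝ} (hr : r ∈ Icc 0 R) :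
    Real.exp (2 * τ * r) * ‖Complex.exp (-(Complex.I * k) * r) * u r‖ ≤
      2 * Real.exp (2 * τ * R) := by
  set g : ℝ → ℂ := fun r : ℝ => Complex.exp (-(Complex.I * k) * r) * u r with hg
  have hgc : ContinuousOn g (Icc 0 R) := hu.continuousOn_exp_mul
  have hmc : ContinuousOn (fun r => Real.exp (2 * τ * r) * ‖g r‖) (Icc 0 R) :=
    ContinuousOn.mul (by fun_prop) hgc.norm
  refine le_two_mul_of_le_add_integral (ε := ‖k‖⁻¹) hR hV hmc
    (fun r _ => by positivity) (by positivity) ?_ (fun r hr => ?_) r hr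
  · rw [inv_mul_le_iff₀ hk0]
    linarith
  · have hsub : uIcc r R ⊆ Icc 0 R := uIcc_subset_Icc hr (right_mem_Icc.2 hR)
    have hi : IntervalIntegrable (fun s => |V s| * (Real.exp (2 * τ * s) * ‖g s‖)) volume r R :=
      hV.abs.intervalIntegrable.mul_continuousOn (hmc.mono hsub)
    have h1 := congrArg norm (hu.volterra_eq hR hV hr)
    rw [norm_mul] at h1
    have h2 : ‖∫ s in r..R, (Complex.exp (2 * Complex.I * k * (s - r)) - 1) * (V s * g s)‖ ≤
        ∫ s in r..R, 2 * Real.exp (-(2 * τ * r)) *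
          (|V s| * (Real.exp (2 * τ * s) * ‖g s‖)) := by
      refine intervalIntegral.norm_integral_le_of_norm_le hr.2
        (Eventually.of_forall fun s hs => ?_) (hi.const_mul _)
      have hsr : 0 ≤ s - r := by linarith [hs.1]
      have h3 := norm_exp_two_mul_I_mul_le hτ hsr
      have h4 : 1 ≤ Real.exp (2 * τ * (s - r)) := Real.one_le_exp (by positivity)
      have h5 : Real.exp (2 * τ * (s - r)) = Real.exp (-(2 * τ * r)) * Real.exp (2 * τ * s) := by
        rw [← Real.exp_add]
        ring_nf
      push_cast at h3
      calc ‖(Complex.exp (2 * Complex.I * k * (s - r)) - 1) * (V s * g s)‖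
          ≤ (Real.exp (2 * τ * (s - r)) + 1) * (|V s| * ‖g s‖) := by
            rw [norm_mul, norm_mul, Complex.norm_real, Real.norm_eq_abs]
            refine mul_le_mul_of_nonneg_right ((norm_sub_le _ _).trans ?_) (by positivity)
            rw [norm_one]
            linarith
        _ ≤ (2 * Real.exp (2 * τ * (s - r))) * (|V s| * ‖g s‖) := by
            refine mul_le_mul_of_nonneg_right (by linarith) (by positivity)
        _ = _ := by rw [h5]; ring
    rw [intervalIntegral.integral_const_mul] at h2
    have h6 : ‖(2 * Complex.I * k : ℂ)‖ = 2 * ‖k‖ := by simp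
    have h7 := norm_add_le (2 * Complex.I * k) (∫ s in r..R,
      (Complex.exp (2 * Complex.I * k * (s - r)) - 1) * (V s * g s))
    rw [h6] at h1 h7
    have h8 : 2 * ‖k‖ * ‖g r‖ ≤ 2 * ‖k‖ + 2 * Real.exp (-(2 * τ * r)) *
        ∫ s in r..R, |V s| * (Real.exp (2 * τ * s) * ‖g s‖) := by linarith
    have h9 : Real.exp (2 * τ * r) * Real.exp (-(2 * τ * r)) = 1 := by
      rw [← Real.exp_add]
      simp
    have h10 : Real.exp (2 * τ * r) ≤ Real.exp (2 * τ * R) := by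
      have := hr.2
      gcongr
    have h11 := mul_le_mul_of_nonneg_left h8 (Real.exp_pos (2 * τ * r)).le
    have h12 : ‖k‖ * (Real.exp (2 * τ * r) * ‖g r‖) ≤ ‖k‖ * Real.exp (2 * τ * R) +
        ∫ s in r..R, |V s| * (Real.exp (2 * τ * s) * ‖g s‖) := by
      have h13 : Real.exp (2 * τ * r) * (2 * Real.exp (-(2 * τ * r)) *
          ∫ s in r..R, |V s| * (Real.exp (2 * τ * s) * ‖g s‖)) =
          2 * ∫ s in r..R, |V s| * (Real.exp (2 * τ * s) * ‖g s‖) := by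
        linear_combination (2 * ∫ s in r..R, |V s| * (Real.exp (2 * τ * s) * ‖g s‖)) * h9
      rw [mul_add, h13] at h11
      have := mul_le_mul_of_nonneg_left h10 hk0.le
      linarith
    rw [← mul_le_mul_iff_right₀ hk0]
    refine h12.trans (le_of_eq ?_)
    field_simp

theorem integral_interval_abs_le {V : ℝ → ℝ} (hV : Integrable V) {a b : ℝ} (hab : a ≤ b) :
    ∫ s in a..b, |V s| ≤ ∫ s, |V s| := by
  rw [intervalIntegral.integral_of_le hab]
  exact setIntegral_le_integral hV.abs (Eventually.of_forall fun _ => abs_nonneg _)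

theorem norm_jostFunction_le {V : ℝ → ℝ} {R : ℝ} (hR : 0 ≤ R)
    (hV : Integrable V) (hV0 : ∀ r, R < r → V r = 0) {k : ℂ} (hk0 : 0 < ‖k‖)
    (hk : 2 * ∫ s, |V s| ≤ ‖k‖) : ‖jostFunction V R k‖ ≤ 2 * Real.exp (2 * R * ‖k‖) := by
  have h := (irregularEigenfunction_spec hR hV hV0 k).norm_exp_mul_le hR hV (norm_nonneg k)
    ((neg_le_abs _).trans (Complex.abs_im_le_norm k)) hk0 hk (left_mem_Icc.2 hR)
  rw [jostFunction_eq hR hV hV0, show 2 * R * ‖k‖ = 2 * ‖k‖ * R by ring]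
  simpa using h

theorem norm_jostFunction_sub_one_le {V : ℝ → ℝ} {R : ℝ} (hR : 0 ≤ R)
    (hV : Integrable V) (hV0 : ∀ r, R < r → V r = 0) {k : ℂ} (hk0 : 0 < ‖k‖)
    (hk : 2 * ∫ s, |V s| ≤ ‖k‖) (him : 0 ≤ k.im) :
    ‖jostFunction V R k - 1‖ ≤ 2 * (∫ s, |V s|) / ‖k‖ := by
  have hu := irregularEigenfunction_spec hR hV hV0 k
  rw [jostFunction_eq hR hV hV0]
  set u := irregularEigenfunction V R k
  have hl := left_mem_Icc.2 hR
  have h := hu.volterra_eq hR hV hl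
  have h2 : ‖∫ s in (0 : ℝ)..R, (Complex.exp (2 * Complex.I * k * (s - (0 : ℝ))) - 1) *
      -- For Im k ≥ 0 the kernel and the normalized eigenfunction are each bounded by 2, hence the
      -- 4.
      (V s * (Complex.exp (-(Complex.I * k) * s) * u s))‖ ≤ ∫ s in (0 : ℝ)..R, |V s| * 4 := by
    refine intervalIntegral.norm_integral_le_of_norm_le hR
      (Eventually.of_forall fun s hs => ?_) (hV.abs.intervalIntegrable.mul_const _)
    have h3 := norm_exp_two_mul_I_mul_le (k := k) (τ := 0) (by linarith) (t := s - 0)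
      (by linarith [hs.1])
    have h4 := hu.norm_exp_mul_le hR hV le_rfl (by linarith) hk0 hk ⟨hs.1.le, hs.2⟩
    simp only [mul_zero, zero_mul, Real.exp_zero, one_mul, mul_one] at h3 h4
    push_cast at h3 ⊢
    have h5 := (norm_sub_le (Complex.exp (2 * Complex.I * k * (s - 0))) 1)
    rw [norm_one] at h5
    rw [norm_mul, norm_mul, Complex.norm_real, Real.norm_eq_abs]
    calc _ ≤ 2 * (|V s| * 2) := by gcongr; linarith
      _ = _ := by ring
  rw [intervalIntegral.integral_mul_const] at h2
  have h3 := integral_interval_abs_le hV hR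
  have h6 : ‖(2 * Complex.I * k : ℂ)‖ = 2 * ‖k‖ := by simp
  have h7 : 2 * Complex.I * k * (u 0 - 1) = ∫ s in (0 : ℝ)..R,
      (Complex.exp (2 * Complex.I * k * (s - (0 : ℝ))) - 1) *
        (V s * (Complex.exp (-(Complex.I * k) * s) * u s)) := by
    rw [mul_sub, mul_one, sub_eq_iff_eq_add', ← h]
    simp
  rw [← h7, norm_mul, h6] at h2
  rw [le_div_iff₀ hk0]
  nlinarith

/-- First Born approximation on the negative imaginary axis. -/
theorem norm_jostFunction_sub_born_le {V : ℝ → ℝ} {R : ℝ} (hR : 0 ≤ R)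
    (hV : Integrable V) (hV0 : ∀ r, R < r → V r = 0) {κ : ℝ} (hκ0 : 0 < κ)
    (hκ : ∫ s, |V s| ≤ κ) :
    ‖2 * κ * (jostFunction V R (-Complex.I * κ) - 1) -
        ((∫ s in (0 : ℝ)..R, (Real.exp (2 * κ * s) - 1) * V s : ℝ) : ℂ)‖ ≤
      (∫ s, |V s|) * ((∫ s in (0 : ℝ)..R, Real.exp (2 * κ * s) * |V s|) / κ) := by
  have hu := irregularEigenfunction_spec hR hV hV0 (-Complex.I * κ)
  rw [jostFunction_eq hR hV hV0]
  set u := irregularEigenfunction V R (-Complex.I * κ)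
  set A := ∫ s in (0 : ℝ)..R, Real.exp (2 * κ * s) * |V s|
  have hIk : Complex.I * (-Complex.I * κ) = κ := by
    linear_combination (-(κ : ℂ)) * Complex.I_sq
  have hIk2 : 2 * Complex.I * (-Complex.I * κ) = 2 * κ := by
    linear_combination (-(2 * κ : ℂ)) * Complex.I_sq
  have hgc := hu.continuousOn_exp_mul
  have heq := fun r (hr : r ∈ Icc 0 R) => hu.volterra_eq hR hV hr
  simp only [hIk2, hIk] at heq hgc
  set g : ℝ → ℂ := fun r : ℝ => Complex.exp (-(κ : ℂ) * r) * u r with hg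
  -- With this weight the kernel acting on the correction g - 1 becomes e^{-2κr} - e^{-2κs}, which
  -- for s ≥ r lies between 0 and e^{-2κr}.
  set m : ℝ → ℂ := fun r => Real.exp (2 * κ * r) * (g r - 1) with hm
  have hmc : ContinuousOn m (Icc 0 R) :=
    ContinuousOn.mul (by fun_prop) (hgc.sub continuousOn_const)
  have hgm (r : ℝ) : g r = 1 + Real.exp (-(2 * κ * r)) * m r := by
    have : (Real.exp (-(2 * κ * r)) : ℂ) * Real.exp (2 * κ * r) = 1 := by
      rw [← Complex.ofReal_mul, ← Real.exp_add]
      simp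
    rw [hm]
    linear_combination (-(g r - 1)) * this
  have hsub (r : ℝ) (hr : r ∈ Icc 0 R) : uIcc r R ⊆ Icc 0 R :=
    uIcc_subset_Icc hr (right_mem_Icc.2 hR)
  have hi1 (r : ℝ) : IntervalIntegrable
      (fun s => (((Real.exp (2 * κ * (s - r)) - 1) * V s : ℝ) : ℂ)) volume r R := by
    have h : IntervalIntegrable (fun s => (Real.exp (2 * κ * (s - r)) - 1) * V s) volume r R :=
      hV.intervalIntegrable.continuousOn_mul (by fun_prop)
    exact ⟨Integrable.ofReal h.1, Integrable.ofReal h.2⟩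
  have hi2 (r : ℝ) (hr : r ∈ Icc 0 R) : IntervalIntegrable
      (fun s => ((Real.exp (-(2 * κ * r)) - Real.exp (-(2 * κ * s)) : ℝ) : ℂ) * (V s * m s))
        volume r R :=
    (hV.ofReal.intervalIntegrable.mul_continuousOn (hmc.mono (hsub r hr))).continuousOn_mul
      (by fun_prop)
  -- Inserting g = 1 + (g - 1) in the integral equation splits off the Born term; the second
  -- integral is the error to be estimated.
  have hdecomp (r : ℝ) (hr : r ∈ Icc 0 R) : 2 * κ * (g r - 1) =
      ((∫ s in r..R, (Real.exp (2 * κ * (s - r)) - 1) * V s : ℝ) : ℂ) +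
      ∫ s in r..R, ((Real.exp (-(2 * κ * r)) - Real.exp (-(2 * κ * s)) : ℝ) : ℂ) *
        (V s * m s) := by
    rw [← intervalIntegral.integral_ofReal, ← intervalIntegral.integral_add
      (hi1 r) (hi2 r hr), mul_sub, heq r hr, mul_one, add_sub_cancel_left]
    refine intervalIntegral.integral_congr fun s _ => ?_
    have e1 : Complex.exp (2 * κ * (s - r)) = (Real.exp (2 * κ * (s - r)) : ℝ) := by
      push_cast
      rfl
    have e2 : (Real.exp (2 * κ * (s - r)) : ℂ) * Real.exp (-(2 * κ * s)) =
        Real.exp (-(2 * κ * r)) := by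
      rw [← Complex.ofReal_mul, ← Real.exp_add]
      ring_nf
    rw [e1, show Complex.exp (-(κ : ℂ) * s) * u s = g s from rfl, hgm s]
    push_cast at e2 ⊢
    linear_combination (V s * m s) * e2
  have hA (r : ℝ) (hr : r ∈ Icc 0 R) : ∫ s in r..R, Real.exp (2 * κ * s) * |V s| ≤ A :=
    intervalIntegral.integral_mono_interval hr.1 hr.2 le_rfl
      (Eventually.of_forall fun s => by positivity)
      (hV.abs.intervalIntegrable.continuousOn_mul (by fun_prop))
  have hmi (r : ℝ) (hr : r ∈ Icc 0 R) :
      IntervalIntegrable (fun s => |V s| * ‖m s‖) volume r R :=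
    hV.abs.intervalIntegrable.mul_continuousOn (hmc.norm.mono (hsub r hr))
  have hbound (r : ℝ) (hr : r ∈ Icc 0 R) :
      ‖∫ s in r..R, ((Real.exp (-(2 * κ * r)) - Real.exp (-(2 * κ * s)) : ℝ) : ℂ) *
        (V s * m s)‖ ≤ Real.exp (-(2 * κ * r)) * ∫ s in r..R, |V s| * ‖m s‖ := by
    rw [← intervalIntegral.integral_const_mul]
    refine intervalIntegral.norm_integral_le_of_norm_le hr.2
      (Eventually.of_forall fun s hs => ?_) ((hmi r hr).const_mul _)
    rw [norm_mul, norm_mul, Complex.norm_real, Complex.norm_real, Real.norm_eq_abs,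
      Real.norm_eq_abs, abs_of_nonneg]
    · gcongr
      linarith [Real.exp_pos (-(2 * κ * s))]
    · rw [sub_nonneg, Real.exp_le_exp]
      have := hs.1
      gcongr
  have hmA : ∀ r ∈ Icc 0 R, ‖m r‖ ≤ 2 * (A / (2 * κ)) := by
    refine le_two_mul_of_le_add_integral (ε := (2 * κ)⁻¹) hR hV hmc.norm
      (fun r _ => norm_nonneg _) (by positivity) ?_ fun r hr => ?_
    · rw [inv_mul_le_iff₀ (by positivity)]
      linarith
    · have h1 : ‖((∫ s in r..R, (Real.exp (2 * κ * (s - r)) - 1) * V s : ℝ) : ℂ)‖ ≤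
          Real.exp (-(2 * κ * r)) * A := by
        rw [Complex.norm_real]
        refine le_trans ?_ (mul_le_mul_of_nonneg_left (hA r hr) (Real.exp_pos _).le)
        rw [← intervalIntegral.integral_const_mul]
        refine intervalIntegral.norm_integral_le_of_norm_le hr.2
          (Eventually.of_forall fun s hs => ?_)
          ((hV.abs.intervalIntegrable.continuousOn_mul (by fun_prop)).const_mul _)
        have h0 : 0 ≤ 2 * κ * (s - r) := mul_nonneg (by positivity) (by linarith [hs.1])
        have h5 : Real.exp (-(2 * κ * r)) * Real.exp (2 * κ * s) = Real.exp (2 * κ * (s - r)) := by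
          rw [← Real.exp_add]
          ring_nf
        rw [norm_mul, Real.norm_eq_abs, Real.norm_eq_abs, ← mul_assoc, h5,
          abs_of_nonneg (by linarith [Real.one_le_exp h0])]
        gcongr
        linarith
      have h2 := congrArg norm (hdecomp r hr)
      have h3 := (norm_add_le _ _).trans (add_le_add h1 (hbound r hr))
      rw [← h2, norm_mul, ← mul_add] at h3
      have h4 : ‖(2 * κ : ℂ)‖ = 2 * κ := by simp [abs_of_pos hκ0]
      rw [h4] at h3
      have h5 : ‖m r‖ = Real.exp (2 * κ * r) * ‖g r - 1‖ := by
        rw [hm, norm_mul, Complex.norm_real, Real.norm_eq_abs, abs_of_pos (Real.exp_pos _)]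
      have h6 := mul_le_mul_of_nonneg_left h3 (Real.exp_pos (2 * κ * r)).le
      rw [← mul_assoc (Real.exp _) (Real.exp _), ← Real.exp_add, add_neg_cancel, Real.exp_zero,
        one_mul] at h6
      rw [h5]
      have h7 : 2 * κ * (Real.exp (2 * κ * r) * ‖g r - 1‖) ≤ A + ∫ s in r..R, |V s| * ‖m s‖ := by
        linarith
      rw [← mul_le_mul_iff_right₀ (show (0 : ℝ) < 2 * κ by positivity)]
      refine h7.trans (le_of_eq ?_)
      field_simp
  have hl := left_mem_Icc.2 hR
  have h0 := hdecomp 0 hl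
  have hg0 : g 0 = u 0 := by simp [hg]
  simp only [sub_zero, hg0] at h0
  rw [h0, add_sub_cancel_left]
  refine (hbound 0 hl).trans ?_
  simp only [mul_zero, neg_zero, Real.exp_zero, one_mul]
  calc ∫ s in (0 : ℝ)..R, |V s| * ‖m s‖ ≤ ∫ s in (0 : ℝ)..R, |V s| * (A / κ) := by
        refine intervalIntegral.integral_mono_on hR (hmi 0 hl)
          (hV.abs.intervalIntegrable.mul_const _) fun s hs => ?_
        refine mul_le_mul_of_nonneg_left ((hmA s hs).trans (le_of_eq ?_)) (abs_nonneg _)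
        field_simp
    _ ≤ _ := by
        rw [intervalIntegral.integral_mul_const]
        refine mul_le_mul_of_nonneg_right (integral_interval_abs_le hV hR) ?_
        exact div_nonneg (intervalIntegral.integral_nonneg hR fun s _ => by positivity) hκ0.le

/-! ### Exponential growth on the negative imaginary axis -/

/-- A nontrivial sum of real powers has constant sign near the origin. -/
theorem exists_sign_sum_rpow {M : ℕ} {d δ : Fin (M + 1) → ℝ} (hδ : StrictMono δ)
    (hd : ∃ n, d n ≠ 0) : ∃ σ : ℝ, (σ = 1 ∨ σ = -1) ∧
      ∀ᶠ x in 𝓝[>] (0 : ℝ), 0 < σ * ∑ n, d n * x ^ δ n := by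
  -- The first nonzero coefficient belongs to the smallest exponent present; after dividing by that
  -- power only its term survives as x → 0.
  obtain ⟨n₀, hn₀, hmin⟩ := wellFounded_lt.has_min {n | d n ≠ 0} hd
  have hlim : Tendsto (fun x : ℝ => ∑ n, d n * x ^ (δ n - δ n₀)) (𝓝[>] 0)
      (𝓝 (∑ n, if n = n₀ then d n₀ else 0)) := by
    refine tendsto_finsetSum _ fun n _ => ?_
    rcases lt_trichotomy n n₀ with h | h | h
    · have : d n = 0 := by
        by_contra hne
        exact hmin n hne h
      simp [this, h.ne]
    · simp [h]
    · have hpos : 0 < δ n - δ n₀ := sub_pos.2 (hδ h)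
      have := (Real.continuousAt_rpow_const 0 (δ n - δ n₀) (Or.inr hpos.le)).tendsto.mono_left
        (nhdsWithin_le_nhds (s := Ioi 0))
      rw [Real.zero_rpow hpos.ne'] at this
      simpa [h.ne'] using this.const_mul (d n)
  simp only [Finset.sum_ite_eq', Finset.mem_univ, if_true] at hlim
  obtain ⟨σ, hσ, hpos⟩ : ∃ σ : ℝ, (σ = 1 ∨ σ = -1) ∧ 0 < σ * d n₀ := by
    rcases lt_or_gt_of_ne (show d n₀ ≠ 0 from hn₀) with h | h
    · exact ⟨-1, Or.inr rfl, by linarith⟩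
    · exact ⟨1, Or.inl rfl, by linarith⟩
  refine ⟨σ, hσ, ?_⟩
  filter_upwards [(hlim.const_mul σ).eventually (lt_mem_nhds hpos), self_mem_nhdsWithin]
    with x hx hx0
  have hx0 : 0 < x := hx0
  have e : σ * ∑ n, d n * x ^ δ n = x ^ δ n₀ * (σ * ∑ n, d n * x ^ (δ n - δ n₀)) := by
    rw [mul_left_comm, Finset.mul_sum (a := x ^ δ n₀)]
    congr 1
    refine Finset.sum_congr rfl fun n _ => ?_
    rw [mul_left_comm, ← Real.rpow_add hx0]
    congr 2
    ring
  rw [e]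
  exact mul_pos (Real.rpow_pos_of_pos hx0 _) hx

theorem exists_sign_potential {V : ℝ → ℝ} {R : ℝ} {M : ℕ} {d δ : Fin (M + 1) → ℝ}
    (hδ : StrictMono δ) (hd : ∃ n, d n ≠ 0)
    (h : Tendsto (fun r : ℝ => V r / ∑ n, d n * (R - r) ^ δ n) (𝓝[<] R) (𝓝 1)) :
    ∃ σ : ℝ, (σ = 1 ∨ σ = -1) ∧ ∃ η, 0 < η ∧ ∀ r ∈ Ioo (R - η) R, 0 < σ * V r := by
  obtain ⟨σ, hσ, hS⟩ := exists_sign_sum_rpow hδ hd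
  have ht : Tendsto (fun r : ℝ => R - r) (𝓝[<] R) (𝓝[>] 0) := by
    refine tendsto_nhdsWithin_of_tendsto_nhds_of_eventually_within _ ?_ ?_
    · have : Tendsto (fun r : ℝ => R - r) (𝓝 R) (𝓝 (R - R)) :=
        (continuous_const.sub continuous_id).tendsto R
      rw [sub_self] at this
      exact this.mono_left nhdsWithin_le_nhds
    · filter_upwards [self_mem_nhdsWithin] with r hr
      exact sub_pos.2 (mem_Iio.1 hr)
  have hev : ∀ᶠ r in 𝓝[<] R, 0 < σ * V r := by
    filter_upwards [ht.eventually hS, h.eventually (lt_mem_nhds one_pos)] with r h1 h2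
    have hne : (∑ n, d n * (R - r) ^ δ n) ≠ 0 := fun h0 => by simp [h0] at h1
    have := mul_pos h1 h2
    rwa [mul_assoc, mul_div_cancel₀ _ hne] at this
  rw [eventually_iff, mem_nhdsLT_iff_exists_Ioo_subset] at hev
  obtain ⟨l, hl, hsub⟩ := hev
  refine ⟨σ, hσ, R - l, sub_pos.2 hl, fun r hr => hsub ?_⟩
  rwa [sub_sub_cancel] at hr

/-- On (R - η, R) the potential has one sign, so the Born integral there has no cancellation. Its
size B is at least a multiple of X e^{κη}, with X = e^{2κ(R-η)}, while everything from [0, R - η] is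
at most X‖V‖₁. The error of the Born approximation costs only about half of B. -/
theorem eventually_exp_le_norm_jostFunction {V : ℝ → ℝ} {R : ℝ} (hR : 0 < R)
    (hV : Integrable V) (hV0 : ∀ r, R < r → V r = 0) {σ η₀ : ℝ} (hσ : σ = 1 ∨ σ = -1)
    (hη₀ : 0 < η₀) (hsign : ∀ r ∈ Ioo (R - η₀) R, 0 < σ * V r) {ε : ℝ} (hε : 0 < ε) :
    ∀ᶠ κ : ℝ in atTop,
      Real.exp ((2 * R - ε) * κ) ≤ ‖jostFunction V R (-Complex.I * κ)‖ := by
  -- 2η ≤ ε ensures that X is at least e^{(2R-ε)κ}.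
  obtain ⟨η, hη, hη1, hη2, hη3⟩ : ∃ η, 0 < η ∧ η ≤ η₀ ∧ η ≤ R ∧ 2 * η ≤ ε :=
    ⟨min η₀ (min R (ε / 2)), by positivity, min_le_left _ _,
      (min_le_right _ _).trans (min_le_left _ _), by
        linarith [(min_le_right η₀ (min R (ε / 2))).trans (min_le_right R (ε / 2))]⟩
  have hσV (r : ℝ) : σ * V r ≤ |V r| ∧ -|V r| ≤ σ * V r := by
    rcases hσ with rfl | rfl
    · rw [one_mul]
      exact ⟨le_abs_self _, neg_abs_le _⟩
    · rw [neg_one_mul]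
      exact ⟨neg_le_abs _, neg_le_neg (le_abs_self _)⟩
  have hσV' (r : ℝ) (hr : r ∈ Ioo (R - η) R) : σ * V r = |V r| := by
    have := hsign r ⟨by linarith [hr.1], hr.2⟩
    rcases hσ with rfl | rfl
    · rw [one_mul] at this ⊢
      exact (abs_of_pos this).symm
    · rw [neg_one_mul] at this ⊢
      exact (abs_of_neg (by linarith)).symm
  have hVne (r : ℝ) (hr : r ∈ Ioo (R - η) R) : 0 < |V r| := by
    rw [← hσV' r hr]
    exact hsign r ⟨by linarith [hr.1], hr.2⟩
  set N := ∫ s, |V s|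
  have hN : 0 ≤ N := integral_nonneg fun _ => abs_nonneg _
  set c := ∫ s in (R - η / 2)..R, |V s| with hc
  have hcpos : 0 < c := by
    refine intervalIntegral.intervalIntegral_pos_of_pos_on hV.abs.intervalIntegrable
      (fun x hx => hVne x ⟨by linarith [hx.1], hx.2⟩) (by linarith)
  -- κ ≥ 2N makes the factor N/κ of the Born error at most 1/2; the last threshold lets the
  -- quadratic lower bound for e^{κη} dominate 3N + 4κ in `hkey`.
  filter_upwards [eventually_ge_atTop 1, eventually_ge_atTop (2 * N),
    eventually_ge_atTop ((3 * N + 4) * 4 / (c * η ^ 2))] with κ hκ1 hκN hκ2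
  have hκ0 : 0 < κ := by linarith
  set F := jostFunction V R (-Complex.I * κ)
  have hborn := norm_jostFunction_sub_born_le hR.le hV hV0 hκ0 (by linarith)
  set A := ∫ s in (0 : ℝ)..R, Real.exp (2 * κ * s) * |V s|
  set I := ∫ s in (0 : ℝ)..R, (Real.exp (2 * κ * s) - 1) * V s
  set X := Real.exp (2 * κ * (R - η)) with hX
  set B := ∫ s in (R - η)..R, Real.exp (2 * κ * s) * |V s| with hB
  have hX1 : 1 ≤ X := Real.one_le_exp (mul_nonneg (by positivity) (by linarith))
  have hA1 (a b : ℝ) : IntervalIntegrable (fun s => Real.exp (2 * κ * s) * |V s|) volume a b :=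
    hV.abs.intervalIntegrable.continuousOn_mul (by fun_prop)
  have hI1 (a b : ℝ) :
      IntervalIntegrable (fun s => (Real.exp (2 * κ * s) - 1) * V s) volume a b :=
    hV.intervalIntegrable.continuousOn_mul (by fun_prop)
  have hexp (s : ℝ) (hs : s ≤ R - η) : Real.exp (2 * κ * s) ≤ X := by
    rw [hX]
    gcongr
  have hRη : 0 ≤ R - η := by linarith
  have hAB : A ≤ X * N + B := by
    have h1 : A = (∫ s in (0 : ℝ)..(R - η), Real.exp (2 * κ * s) * |V s|) + B :=
      (intervalIntegral.integral_add_adjacent_intervals (hA1 _ _) (hA1 _ _)).symm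
    have h2 : ∫ s in (0 : ℝ)..(R - η), Real.exp (2 * κ * s) * |V s| ≤
        ∫ s in (0 : ℝ)..(R - η), X * |V s| := by
      refine intervalIntegral.integral_mono_on hRη (hA1 _ _)
        (hV.abs.intervalIntegrable.const_mul _) fun s hs => ?_
      exact mul_le_mul_of_nonneg_right (hexp s hs.2) (abs_nonneg _)
    rw [intervalIntegral.integral_const_mul] at h2
    have h3 := mul_le_mul_of_nonneg_left (integral_interval_abs_le hV hRη)
      (zero_le_one.trans hX1)
    linarith
  have hIB : B - N - X * N ≤ σ * I := by
    have h1 : I = (∫ s in (0 : ℝ)..(R - η), (Real.exp (2 * κ * s) - 1) * V s) +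
        ∫ s in (R - η)..R, (Real.exp (2 * κ * s) - 1) * V s :=
      (intervalIntegral.integral_add_adjacent_intervals (hI1 _ _) (hI1 _ _)).symm
    have h2 : ∫ s in (0 : ℝ)..(R - η), -(X * |V s|) ≤
        σ * ∫ s in (0 : ℝ)..(R - η), (Real.exp (2 * κ * s) - 1) * V s := by
      rw [← intervalIntegral.integral_const_mul]
      refine intervalIntegral.integral_mono_on hRη
        (hV.abs.intervalIntegrable.const_mul _).neg ((hI1 _ _).const_mul _) fun s hs => ?_
      have h3 : 0 ≤ Real.exp (2 * κ * s) - 1 :=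
        sub_nonneg.2 (Real.one_le_exp (mul_nonneg (by positivity) hs.1))
      have h4 := mul_le_mul_of_nonneg_left (hσV s).2 h3
      have h5 : (Real.exp (2 * κ * s) - 1) * |V s| ≤ X * |V s| :=
        mul_le_mul_of_nonneg_right (by linarith [hexp s hs.2]) (abs_nonneg _)
      linarith
    rw [intervalIntegral.integral_neg, intervalIntegral.integral_const_mul] at h2
    have h6 : ∫ s in (R - η)..R, (Real.exp (2 * κ * s) * |V s| - |V s|) =
        σ * ∫ s in (R - η)..R, (Real.exp (2 * κ * s) - 1) * V s := by
      rw [← intervalIntegral.integral_const_mul]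
      refine intervalIntegral.integral_congr_ae ?_
      have hne : ∀ᵐ s : ℝ, s ≠ R := by simp [ae_iff, measure_singleton]
      filter_upwards [hne] with s hs hm
      rw [uIoc_of_le (by linarith)] at hm
      rw [← hσV' s ⟨hm.1, lt_of_le_of_ne hm.2 hs⟩]
      ring
    rw [intervalIntegral.integral_sub (hA1 _ _) hV.abs.intervalIntegrable] at h6
    have h7 := mul_le_mul_of_nonneg_left (integral_interval_abs_le hV hRη)
      (zero_le_one.trans hX1)
    have h8 := integral_interval_abs_le hV (show R - η ≤ R by linarith)
    rw [h1, mul_add, ← h6]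
    linarith
  have hBX : X * (c * Real.exp (κ * η)) ≤ B := by
    have h1 : ∫ s in (R - η / 2)..R, Real.exp (2 * κ * (R - η / 2)) * |V s| ≤
        ∫ s in (R - η / 2)..R, Real.exp (2 * κ * s) * |V s| := by
      refine intervalIntegral.integral_mono_on (by linarith)
        (hV.abs.intervalIntegrable.const_mul _) (hA1 _ _) fun s hs => ?_
      have := hs.1
      gcongr
    have h2 : ∫ s in (R - η / 2)..R, Real.exp (2 * κ * s) * |V s| ≤ B :=
      intervalIntegral.integral_mono_interval (by linarith) (by linarith) le_rfl
        (Eventually.of_forall fun s => by positivity) (hA1 _ _)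
    rw [intervalIntegral.integral_const_mul] at h1
    refine le_trans (le_of_eq ?_) (h1.trans h2)
    rw [← hc, mul_left_comm, hX, ← Real.exp_add, mul_comm]
    ring_nf
  have hIabs : σ * I ≤ |I| := by
    rcases hσ with rfl | rfl
    · rw [one_mul]
      exact le_abs_self _
    · rw [neg_one_mul]
      exact neg_le_abs _
  have hnorm : |I| - N * (A / κ) ≤ 2 * κ * (‖F‖ + 1) := by
    have h1 : ‖(2 * κ : ℂ) * (F - 1)‖ ≤ 2 * κ * (‖F‖ + 1) := by
      rw [norm_mul]
      have : ‖(2 * κ : ℂ)‖ = 2 * κ := by simp [abs_of_pos hκ0]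
      rw [this]
      gcongr
      simpa using norm_sub_le F 1
    have h2 := norm_sub_norm_le (I : ℂ) (2 * κ * (F - 1))
    rw [norm_sub_rev, Complex.norm_real, Real.norm_eq_abs] at h2
    linarith
  have hNA : N * (A / κ) ≤ (X * N + B) / 2 := by
    rw [mul_div_assoc', div_le_iff₀ hκ0]
    have hA0 : 0 ≤ A := intervalIntegral.integral_nonneg hR.le fun s _ => by positivity
    nlinarith
  have hquad := Real.quadratic_le_exp_of_nonneg (show 0 ≤ κ * η by positivity)
  have hkey : 3 * N + 4 * κ ≤ c * Real.exp (κ * η) / 2 := by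
    rw [div_le_iff₀ (by positivity)] at hκ2
    have h1 : (κ * η) ^ 2 / 2 ≤ Real.exp (κ * η) := by
      have : 0 ≤ κ * η := by positivity
      linarith
    have h2 := mul_le_mul_of_nonneg_left h1 hcpos.le
    have h3 := mul_le_mul_of_nonneg_right hκ2 hκ0.le
    nlinarith
  -- The estimates combine to 2X ≤ ‖F‖ + 1, and X ≥ 1 removes the extra one.
  have hfin : X ≤ ‖F‖ := by
    have h1 := mul_le_mul_of_nonneg_left hkey (zero_le_one.trans hX1)
    have h2 : N ≤ X * N := le_mul_of_one_le_left hN hX1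
    have h3 : X * (4 * κ) ≤ 2 * κ * (‖F‖ + 1) := by nlinarith
    have h4 : 2 * κ * (2 * X) ≤ 2 * κ * (‖F‖ + 1) := by linarith
    have h5 := le_of_mul_le_mul_left h4 (by positivity)
    linarith
  refine le_trans ?_ hfin
  rw [hX, Real.exp_le_exp]
  nlinarith

/-! ### Zeros of entire functions of exponential growth -/

theorem analyticOrderAt_ne_top_of_apply_ne_zero {f : ℂ → ℂ} (hf : Differentiable ℂ f) {a : ℂ}
    (ha : f a ≠ 0) (w : ℂ) : analyticOrderAt f w ≠ ⊤ := by
  have hA : AnalyticOnNhd ℂ f univ := fun z _ => hf.analyticAt z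
  refine hA.analyticOrderAt_ne_top_of_isPreconnected isPreconnected_univ (mem_univ a)
    (mem_univ w) ?_
  rw [analyticOrderAt_eq_zero.2 (Or.inr ha)]
  exact ENat.zero_ne_top

theorem exists_eq_pow_mul_of_entire {f : ℂ → ℂ} (hf : Differentiable ℂ f) {w : ℂ}
    (hw : analyticOrderAt f w ≠ ⊤) : ∃ h : ℂ → ℂ, Differentiable ℂ h ∧ h w ≠ 0 ∧
      ∀ z, f z = (z - w) ^ analyticOrderNatAt f w * h z := by
  classical
  obtain ⟨g, hg, hgw, hfg⟩ := (hf.analyticAt w).analyticOrderAt_ne_top.1 hw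
  set n := analyticOrderNatAt f w
  set h : ℂ → ℂ := Function.update (fun z => f z / (z - w) ^ n) w (g w) with hh
  have hne (z : ℂ) (hz : z ≠ w) : h z = f z / (z - w) ^ n := Function.update_of_ne hz _ _
  have hhw : h w = g w := Function.update_self _ _ _
  have heq : h =ᶠ[𝓝 w] g := by
    filter_upwards [hfg] with z hz
    rcases eq_or_ne z w with rfl | hzw
    · exact hhw
    · rw [hne z hzw, hz, smul_eq_mul, mul_div_cancel_left₀ _ (pow_ne_zero _ (sub_ne_zero.2 hzw))]
  refine ⟨h, fun z => ?_, hhw ▸ hgw, fun z => ?_⟩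
  · rcases eq_or_ne z w with rfl | hzw
    · exact hg.differentiableAt.congr_of_eventuallyEq heq
    · have : h =ᶠ[𝓝 z] fun z => f z / (z - w) ^ n := by
        filter_upwards [isOpen_ne.mem_nhds hzw] with y hy using hne y hy
      have hpd : DifferentiableAt ℂ (fun y => (y - w) ^ n) z := by fun_prop
      have hp0 : (z - w) ^ n ≠ 0 := pow_ne_zero _ (sub_ne_zero.2 hzw)
      exact ((hf z).div hpd hp0).congr_of_eventuallyEq this
  · rcases eq_or_ne z w with rfl | hzw
    · rw [hhw]
      exact hfg.self_of_nhds
    · rw [hne z hzw, mul_div_cancel₀ _ (pow_ne_zero _ (sub_ne_zero.2 hzw))]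

/-- Finitely many zeros are split off an entire function. -/
theorem exists_eq_prod_mul_of_entire {f : ℂ → ℂ} (hf : Differentiable ℂ f) (hf0 : f 0 ≠ 0)
    (S : Finset ℂ) (hS : ∀ w ∈ S, w ≠ 0) : ∃ E : ℂ → ℂ, Differentiable ℂ E ∧ (∀ w ∈ S, E w ≠ 0) ∧
      ∀ z, f z = (∏ w ∈ S, (1 - z / w) ^ analyticOrderNatAt f w) * E z := by
  classical
  induction S using Finset.induction_on with
  | empty => exact ⟨f, hf, by simp, by simp⟩
  | insert a S haS ih =>
    obtain ⟨E, hE, hES, hfE⟩ := ih fun w hw => hS w (Finset.mem_insert_of_mem hw)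
    have ha : a ≠ 0 := hS a (Finset.mem_insert_self _ _)
    set P : ℂ → ℂ := fun z => ∏ w ∈ S, (1 - z / w) ^ analyticOrderNatAt f w with hP
    have hPd : Differentiable ℂ P := by fun_prop
    have hPa : P a ≠ 0 := by
      refine Finset.prod_ne_zero_iff.2 fun w hw => pow_ne_zero _ (sub_ne_zero.2 fun h => ?_)
      have hw0 := hS w (Finset.mem_insert_of_mem hw)
      rw [eq_div_iff hw0, one_mul] at h
      exact haS (h ▸ hw)
    have hE0 : E 0 ≠ 0 := fun h => hf0 (by rw [hfE, h, mul_zero])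
    have hEa := analyticOrderAt_ne_top_of_apply_ne_zero hE hE0 a
    -- The factors already split off do not vanish at `a`, so they leave the order there unchanged.
    have hord : analyticOrderNatAt f a = analyticOrderNatAt E a := by
      have h1 : f = P * E := funext hfE
      have h2 : analyticOrderAt P a = 0 := analyticOrderAt_eq_zero.2 (Or.inr hPa)
      have h3 : analyticOrderAt f a = analyticOrderAt E a := by
        rw [h1, analyticOrderAt_mul (hPd.analyticAt a) (hE.analyticAt a), h2, zero_add]
      rw [analyticOrderNatAt, h3, analyticOrderNatAt]
    obtain ⟨h, hh, hha, hEh⟩ := exists_eq_pow_mul_of_entire hE hEa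
    have hEh' (z : ℂ) : E z = (1 - z / a) ^ analyticOrderNatAt f a *
        ((-a) ^ analyticOrderNatAt f a * h z) := by
      rw [hEh, hord, ← mul_assoc, ← mul_pow]
      congr 2
      field_simp
      ring
    refine ⟨fun z => (-a) ^ analyticOrderNatAt f a * h z, by fun_prop, fun w hw => ?_,
      fun z => ?_⟩
    · rcases Finset.mem_insert.1 hw with rfl | hwS
      · exact mul_ne_zero (pow_ne_zero _ (neg_ne_zero.2 ha)) hha
      · intro h0
        simp only at h0
        exact hES w hwS (by rw [hEh', h0, mul_zero])
    · rw [Finset.prod_insert haS, hfE, hEh']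
      ring

/-- A substitute for Jensen's formula: on |y| = 3ρ each factor satisfies |1 - y/w| ≥ 2 because |w| ≤
ρ, and the maximum principle carries the resulting bound on E inside. -/
theorem norm_mul_two_pow_le {f E : ℂ → ℂ} {C c ρ : ℝ} (hρ : 0 < ρ)
    (hfC : ∀ z, ‖f z‖ ≤ C * Real.exp (c * ‖z‖)) (hE : Differentiable ℂ E) (S : Finset ℂ)
    (hS : ∀ w ∈ S, w ≠ 0 ∧ ‖w‖ ≤ ρ) (m : ℂ → ℕ)
    (hfE : ∀ z, f z = (∏ w ∈ S, (1 - z / w) ^ m w) * E z) {z : ℂ} (hz : ‖z‖ ≤ 3 * ρ) :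
    ‖E z‖ * 2 ^ (∑ w ∈ S, m w) ≤ C * Real.exp (3 * c * ρ) := by
  rw [← le_div_iff₀ (by positivity)]
  have h3 : (3 * ρ) ≠ 0 := by positivity
  refine Complex.norm_le_of_forall_mem_frontier_norm_le (U := Metric.ball 0 (3 * ρ))
    Metric.isBounded_ball hE.diffContOnCl (fun y hy => ?_)
    (by rwa [closure_ball _ h3, mem_closedBall_zero_iff])
  rw [frontier_ball _ h3, mem_sphere_zero_iff_norm] at hy
  rw [le_div_iff₀ (by positivity)]
  have h1 := hfC y
  rw [hfE y, norm_mul, hy, norm_prod, show c * (3 * ρ) = 3 * c * ρ by ring] at h1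
  refine le_trans ?_ h1
  rw [mul_comm, ← Finset.prod_pow_eq_pow_sum]
  refine mul_le_mul_of_nonneg_right (Finset.prod_le_prod (fun _ _ => by positivity)
    fun w hw => ?_) (norm_nonneg _)
  rw [norm_pow]
  refine pow_le_pow_left₀ (by norm_num) ?_ _
  obtain ⟨hw0, hwρ⟩ := hS w hw
  have hw0 : 0 < ‖w‖ := norm_pos_iff.2 hw0
  have h2 : 3 ≤ ‖y / w‖ := by
    rw [norm_div, hy, le_div_iff₀ hw0]
    linarith
  have h4 := norm_sub_norm_le (y / w) 1
  rw [norm_one, norm_sub_rev] at h4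
  linarith

/-- An entire function of exponential growth has `O(ρ)` zeros of modulus at most `ρ`. -/
theorem exists_sum_order_le {f : ℂ → ℂ} (hf : Differentiable ℂ f) (hf0 : f 0 ≠ 0) {C c : ℝ}
    (hfC : ∀ z, ‖f z‖ ≤ C * Real.exp (c * ‖z‖)) : ∃ K : ℝ, 0 < K ∧ ∀ ρ : ℝ, 0 < ρ →
      ∀ S : Finset ℂ, (∀ w ∈ S, w ≠ 0 ∧ ‖w‖ ≤ ρ) →
        (∑ w ∈ S, (analyticOrderNatAt f w : ℝ)) ≤ K * (1 + ρ) := by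
  have hpos : 0 < ‖f 0‖ := norm_pos_iff.2 hf0
  have hC : 0 < C := by
    have := hfC 0
    rw [norm_zero, mul_zero, Real.exp_zero, mul_one] at this
    linarith
  have hl2 := Real.log_pos one_lt_two
  refine ⟨(|Real.log (C / ‖f 0‖)| + 3 * |c| + 1) / Real.log 2, by positivity,
    fun ρ hρ S hS => ?_⟩
  obtain ⟨E, hE, -, hfE⟩ := exists_eq_prod_mul_of_entire hf hf0 S fun w hw => (hS w hw).1
  have h := norm_mul_two_pow_le hρ hfC hE S hS _ hfE (z := 0) (by simpa using hρ.le)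
  have hE0 : E 0 = f 0 := by simp [hfE 0]
  rw [hE0, mul_comm, ← le_div_iff₀ hpos] at h
  have h1 := Real.log_le_log (by positivity) h
  rw [Real.log_pow, mul_div_right_comm, Real.log_mul (by positivity) (by positivity),
    Real.log_exp] at h1
  push_cast at h1
  rw [div_mul_eq_mul_div, le_div_iff₀ hl2]
  refine h1.trans ?_
  have h2 := le_abs_self (Real.log (C / ‖f 0‖))
  have h3 := mul_le_mul_of_nonneg_right (le_abs_self c) hρ.le
  have h4 := mul_nonneg (abs_nonneg (Real.log (C / ‖f 0‖))) hρ.le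
  nlinarith [abs_nonneg c]

/-- Zeros stay at distance r₀ from the origin, so a nonempty sum forces ρ ≥ r₀ and the additive
constant in K(1 + ρ) can be absorbed. -/
theorem exists_sum_order_le_mul {f : ℂ → ℂ} (hf : Differentiable ℂ f) (hf0 : f 0 ≠ 0) {C c : ℝ}
    (hfC : ∀ z, ‖f z‖ ≤ C * Real.exp (c * ‖z‖)) : ∃ K r₀ : ℝ, 0 < K ∧ 0 < r₀ ∧
      (∀ w, f w = 0 → r₀ ≤ ‖w‖) ∧ ∀ ρ : ℝ, 0 < ρ → ∀ S : Finset ℂ,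
        (∀ w ∈ S, f w = 0 ∧ ‖w‖ ≤ ρ) → (∑ w ∈ S, (analyticOrderNatAt f w : ℝ)) ≤ K * ρ := by
  obtain ⟨K, hK, hsum⟩ := exists_sum_order_le hf hf0 hfC
  obtain ⟨r₀, hr₀, hball⟩ := Metric.eventually_nhds_iff.1
    (hf.continuous.continuousAt.eventually_ne hf0)
  have hz (w : ℂ) (hw : f w = 0) : r₀ ≤ ‖w‖ := by
    by_contra h
    push Not at h
    exact hball (by rwa [dist_zero_right]) hw
  refine ⟨K * (1 / r₀ + 1), r₀, by positivity, hr₀, hz, fun ρ hρ S hS => ?_⟩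
  rcases S.eq_empty_or_nonempty with rfl | ⟨w, hw⟩
  · simp
    positivity
  · have h1 : r₀ ≤ ρ := (hz w (hS w hw).1).trans (hS w hw).2
    refine (hsum ρ hρ S fun w hw => ⟨?_, (hS w hw).2⟩).trans ?_
    · rintro rfl
      exact hf0 (hS _ hw).1
    · rw [mul_assoc]
      refine mul_le_mul_of_nonneg_left ?_ hK.le
      have : 1 ≤ 1 / r₀ * ρ := by
        rw [div_mul_eq_mul_div, one_mul, le_div_iff₀ hr₀, one_mul]
        exact h1
      linarith

/-- Dyadic layers: zeros with r₀2^j ≤ |z| ≤ r₀2^{j+1} have total multiplicity O(2^j) and contribute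
O(2^{(1-α)j}), a convergent geometric series. -/
theorem summable_order_div_rpow {f : ℂ → ℂ} (hf : Differentiable ℂ f) (hf0 : f 0 ≠ 0) {C c : ℝ}
    (hfC : ∀ z, ‖f z‖ ≤ C * Real.exp (c * ‖z‖)) {α : ℝ} (hα : 1 < α) :
    Summable fun z : {z : ℂ // f z = 0 ∧ z ≠ 0} =>
      (analyticOrderNatAt f z : ℝ) * (1 / ‖(z : ℂ)‖ ^ α) := by
  classical
  obtain ⟨K, r₀, hK, hr₀, hz, hsum⟩ := exists_sum_order_le_mul hf hf0 hfC
  set x : ℝ := 2 ^ (1 - α) with hx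
  have hx0 : 0 < x := Real.rpow_pos_of_pos two_pos _
  have hx1 : x < 1 := Real.rpow_lt_one_of_one_lt_of_neg one_lt_two (by linarith)
  set D : ℝ := 2 * K * r₀ / r₀ ^ α with hD
  have hD0 : 0 < D := by positivity
  refine summable_of_sum_le (c := D * (1 - x)⁻¹) (fun z => by positivity) fun s => ?_
  set lev : {z : ℂ // f z = 0 ∧ z ≠ 0} → ℕ := fun z => Nat.log 2 ⌊‖(z : ℂ)‖ / r₀⌋₊ with hlev
  have hone (z : {z : ℂ // f z = 0 ∧ z ≠ 0}) : 1 ≤ ‖(z : ℂ)‖ / r₀ := by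
    rw [le_div_iff₀ hr₀, one_mul]
    exact hz z z.2.1
  have hlow (z : {z : ℂ // f z = 0 ∧ z ≠ 0}) : r₀ * 2 ^ lev z ≤ ‖(z : ℂ)‖ := by
    have h1 : 2 ^ lev z ≤ ⌊‖(z : ℂ)‖ / r₀⌋₊ :=
      Nat.pow_log_le_self 2 (Nat.floor_pos.2 (hone z)).ne'
    have h2 := (Nat.le_floor_iff (by positivity)).1 h1
    push_cast at h2
    rw [le_div_iff₀ hr₀] at h2
    linarith
  have hup (z : {z : ℂ // f z = 0 ∧ z ≠ 0}) : ‖(z : ℂ)‖ ≤ r₀ * 2 ^ (lev z + 1) := by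
    have h1 := Nat.lt_pow_succ_log_self (b := 2) one_lt_two ⌊‖(z : ℂ)‖ / r₀⌋₊
    have h2 := (Nat.floor_lt (by positivity)).1 h1
    push_cast at h2
    rw [div_lt_iff₀ hr₀] at h2
    rw [mul_comm]
    exact h2.le
  have hlayer (j : ℕ) : ∑ z ∈ s with lev z = j,
      (analyticOrderNatAt f z : ℝ) * (1 / ‖(z : ℂ)‖ ^ α) ≤ D * x ^ j := by
    have h1 : ∑ z ∈ s with lev z = j, (analyticOrderNatAt f z : ℝ) ≤ K * (r₀ * 2 ^ (j + 1)) := by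
      have := hsum (r₀ * 2 ^ (j + 1)) (by positivity)
        ((s.filter fun z => lev z = j).map (Function.Embedding.subtype _)) (fun w hw => by
          obtain ⟨z, hzm, rfl⟩ := Finset.mem_map.1 hw
          have h3 := hup z
          rw [(Finset.mem_filter.1 hzm).2] at h3
          exact ⟨z.2.1, h3⟩)
      rw [Finset.sum_map] at this
      exact this
    calc ∑ z ∈ s with lev z = j, (analyticOrderNatAt f z : ℝ) * (1 / ‖(z : ℂ)‖ ^ α)
        ≤ ∑ z ∈ s with lev z = j, (analyticOrderNatAt f z : ℝ) * (1 / (r₀ * 2 ^ j) ^ α) := by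
          refine Finset.sum_le_sum fun z hzm => ?_
          have h3 := hlow z
          rw [(Finset.mem_filter.1 hzm).2] at h3
          gcongr
      _ ≤ K * (r₀ * 2 ^ (j + 1)) * (1 / (r₀ * 2 ^ j) ^ α) := by
          rw [← Finset.sum_mul]
          gcongr
      _ = D * x ^ j := by
          have e1 : x ^ j = 2 ^ j / ((2 : ℝ) ^ j) ^ α := by
            rw [hx, ← Real.rpow_natCast, ← Real.rpow_mul two_pos.le, ← Real.rpow_natCast 2 j,
              ← Real.rpow_mul two_pos.le, ← Real.rpow_sub two_pos]
            congr 1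
            ring
          rw [e1, hD, Real.mul_rpow hr₀.le (by positivity), pow_succ]
          field_simp
  have hmaps : ∀ z ∈ s, lev z ∈ Finset.range (s.sup lev + 1) := fun z hz =>
    Finset.mem_range.2 (Nat.lt_succ_of_le (Finset.le_sup hz))
  rw [← Finset.sum_fiberwise_of_maps_to hmaps]
  calc _ ≤ ∑ j ∈ Finset.range (s.sup lev + 1), D * x ^ j :=
        Finset.sum_le_sum fun j _ => hlayer j
    _ = D * ∑ j ∈ Finset.range (s.sup lev + 1), x ^ j := by rw [Finset.mul_sum]
    _ ≤ D * (1 - x)⁻¹ := by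
        refine mul_le_mul_of_nonneg_left ?_ hD0.le
        rw [← tsum_geometric_of_lt_one hx0.le hx1]
        exact (summable_geometric_of_lt_one hx0.le hx1).sum_le_tsum _ fun _ _ => by positivity

/-- L is the primitive of E'/E on the ball that vanishes at 0; then E e^{-L} has zero derivative and
is constant. -/
theorem exists_log_of_ball {E : ℂ → ℂ} {ρ : ℝ} (hρ : 0 < ρ) (hE : Differentiable ℂ E)
    (hE0 : ∀ z ∈ Metric.ball (0 : ℂ) ρ, E z ≠ 0) : ∃ L : ℂ → ℂ,
      DifferentiableOn ℂ L (Metric.ball 0 ρ) ∧ L 0 = 0 ∧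
        ∀ z ∈ Metric.ball (0 : ℂ) ρ, E z = E 0 * Complex.exp (L z) := by
  have hd : DifferentiableOn ℂ (fun z => deriv E z / E z) (Metric.ball 0 ρ) :=
    hE.deriv.differentiableOn.div hE.differentiableOn hE0
  obtain ⟨L, hL⟩ := hd.isExactOn_ball.with_val_at 0 0
  obtain ⟨hL0, hL⟩ := hL
  have h0 : (0 : ℂ) ∈ Metric.ball (0 : ℂ) ρ := Metric.mem_ball_self hρ
  refine ⟨L, fun z hz => (hL _ hz).differentiableAt.differentiableWithinAt, hL0, fun z hz => ?_⟩
  have hder (y : ℂ) (hy : y ∈ Metric.ball (0 : ℂ) ρ) :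
      HasDerivAt (fun z => E z * Complex.exp (-L z)) 0 y := by
    refine ((hE y).hasDerivAt.mul (hL _ hy).neg.cexp).congr_deriv ?_
    have := hE0 y hy
    simp only [Pi.neg_apply]
    field_simp
    ring
  have hconst : E z * Complex.exp (-L z) = E 0 * Complex.exp (-L 0) :=
    (convex_ball (0 : ℂ) ρ).is_const_of_fderivWithin_eq_zero (𝕜 := ℂ)
      (fun y hy => (hder y hy).differentiableAt.differentiableWithinAt)
      (fun y hy => by
        rw [fderivWithin_of_isOpen Metric.isOpen_ball hy]
        ext
        simp [(hder y hy).deriv]) hz h0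
  rw [hL0, neg_zero, Complex.exp_zero, mul_one] at hconst
  rw [← hconst, mul_assoc, ← Complex.exp_add]
  simp

/-- Subadditivity of t ↦ t^α gives (1 + x)^α ≤ 1 + x^α ≤ e^{x^α}; then take the α-th root. -/
theorem one_add_le_exp_rpow_div {x α : ℝ} (hx : 0 ≤ x) (hα : 0 < α) (hα1 : α ≤ 1) :
    1 + x ≤ Real.exp (x ^ α / α) := by
  have h1 : (1 + x) ^ α ≤ 1 ^ α + x ^ α := by
    lift x to NNReal using hx
    exact_mod_cast NNReal.rpow_add_le_add_rpow 1 x hα.le hα1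
  have h2 : (1 + x) ^ α ≤ Real.exp (x ^ α) := by
    rw [Real.one_rpow] at h1
    linarith [Real.add_one_le_exp (x ^ α)]
  have h3 := Real.rpow_le_rpow (by positivity) h2 (inv_nonneg.2 hα.le)
  rwa [Real.rpow_rpow_inv (by positivity) hα.ne', ← Real.exp_mul, ← div_eq_mul_inv] at h3

/-- If the zeros of an entire function `f` of exponential growth have convergence exponent less
than one, then `f(z) f(-z)` has order less than one. -/
theorem norm_mul_neg_le_of_summable {f : ℂ → ℂ} (hf : Differentiable ℂ f) (hf0 : f 0 ≠ 0)
    {C c : ℝ} (hfC : ∀ z, ‖f z‖ ≤ C * Real.exp (c * ‖z‖)) {α : ℝ} (hα : 0 < α) (hα1 : α ≤ 1)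
    (hs : Summable fun z : {z : ℂ // f z = 0 ∧ z ≠ 0} =>
      (analyticOrderNatAt f z : ℝ) * (1 / ‖(z : ℂ)‖ ^ α)) :
    ∃ A : ℝ, ∀ z, ‖f z * f (-z)‖ ≤ ‖f 0‖ ^ 2 * Real.exp (A * ‖z‖ ^ α) := by
  classical
  obtain ⟨K, hK, hsum⟩ := exists_sum_order_le hf hf0 hfC
  have hpos : 0 < ‖f 0‖ := norm_pos_iff.2 hf0
  have hC : 0 < C := by
    have := hfC 0
    rw [norm_zero, mul_zero, Real.exp_zero, mul_one] at this
    linarith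
  have hne0 (w : ℂ) (hw : f w = 0) : w ≠ 0 := fun h => hf0 (h ▸ hw)
  set m : ℂ → ℕ := analyticOrderNatAt f with hm
  have hm1 (w : ℂ) (hw : f w = 0) : 1 ≤ m w := by
    rw [Nat.one_le_iff_ne_zero, hm, analyticOrderNatAt, Ne, ENat.toNat_eq_zero, not_or]
    exact ⟨analyticOrderAt_ne_zero.2 ⟨hf.analyticAt w, hw⟩,
      analyticOrderAt_ne_top_of_apply_ne_zero hf hf0 w⟩
  -- Each zero has multiplicity at least one, so infinitely many in a disc would violate the
  -- counting bound.
  have hfin (ρ : ℝ) (hρ : 0 < ρ) : {w : ℂ | f w = 0 ∧ ‖w‖ ≤ ρ}.Finite := by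
    by_contra hinf
    obtain ⟨t, ht, hcard⟩ := Set.Infinite.exists_subset_card_eq hinf (⌊K * (1 + ρ)⌋₊ + 1)
    have h1 := hsum ρ hρ t fun w hw => ⟨hne0 w (ht hw).1, (ht hw).2⟩
    have h2 : (t.card : ℝ) ≤ ∑ w ∈ t, (m w : ℝ) := by
      rw [Finset.card_eq_sum_ones]
      push_cast
      exact Finset.sum_le_sum fun w hw => by exact_mod_cast hm1 w (ht hw).1
    have h3 := Nat.lt_floor_add_one (K * (1 + ρ))
    rw [hcard] at h2
    push_cast at h2
    linarith
  set σ := ∑' z : {z : ℂ // f z = 0 ∧ z ≠ 0}, (m z : ℝ) * (1 / ‖(z : ℂ)‖ ^ α)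
  set M₀ := |Real.log (C / ‖f 0‖)| + 3 * |c| + 1 with hM₀
  refine ⟨2 * (σ / α), fun z => ?_⟩
  -- This plays the role of Hadamard factorization: for each large ρ the zeros in |w| ≤ ρ are split
  -- off, and the zero-free remainder contributes an error factor that tends to 1 as ρ → ∞.
  have key : ∀ᶠ ρ : ℝ in atTop, ‖f z * f (-z)‖ ≤
      ‖f 0‖ ^ 2 * Real.exp (2 * (σ / α) * ‖z‖ ^ α) *
        Real.exp (4 * (M₀ * (1 + ρ)) * (‖z‖ / (ρ / 2)) ^ 2) := by
    filter_upwards [eventually_gt_atTop 0, eventually_gt_atTop (2 * ‖z‖)] with ρ hρ hzρ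
    set S := (hfin ρ hρ).toFinset with hS
    have hmemS (w : ℂ) : w ∈ S ↔ f w = 0 ∧ ‖w‖ ≤ ρ := by simp [hS]
    obtain ⟨E, hE, hES, hfE⟩ := exists_eq_prod_mul_of_entire hf hf0 S
      fun w hw => hne0 w ((hmemS w).1 hw).1
    have hE00 : E 0 = f 0 := by simp [hfE 0]
    have hEne (y : ℂ) (hy : y ∈ Metric.ball (0 : ℂ) ρ) : E y ≠ 0 := by
      intro h
      have h1 : f y = 0 := by rw [hfE, h, mul_zero]
      exact hES y ((hmemS y).2 ⟨h1, (mem_ball_zero_iff.1 hy).le⟩) h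
    obtain ⟨L, hL, hL0, hEL⟩ := exists_log_of_ball hρ hE hEne
    have hM : 0 < M₀ * (1 + ρ) := by positivity
    have hre (y : ℂ) (hy : y ∈ Metric.ball (0 : ℂ) ρ) : (L y).re ≤ M₀ * (1 + ρ) := by
      have hyρ := mem_ball_zero_iff.1 hy
      have h1 := norm_mul_two_pow_le hρ hfC hE S
        (fun w hw => ⟨hne0 w ((hmemS w).1 hw).1, ((hmemS w).1 hw).2⟩) _ hfE (z := y)
        (by linarith)
      have h2 : ‖E y‖ ≤ C * Real.exp (3 * c * ρ) :=
        (le_mul_of_one_le_right (norm_nonneg _) (one_le_pow₀ one_le_two)).trans h1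
      rw [hEL y hy, hE00, norm_mul, Complex.norm_exp, mul_comm, ← le_div_iff₀ hpos] at h2
      have h3 := Real.log_le_log (Real.exp_pos _) h2
      rw [Real.log_exp, mul_div_right_comm, Real.log_mul (by positivity) (by positivity),
        Real.log_exp] at h3
      have h4 := le_abs_self (Real.log (C / ‖f 0‖))
      have h5 := mul_le_mul_of_nonneg_right (le_abs_self c) hρ.le
      have h6 := mul_nonneg (abs_nonneg (Real.log (C / ‖f 0‖))) hρ.le
      nlinarith [abs_nonneg c]
    -- Borel–Carathéodory turns the O(ρ) bound on Re L into one on |L| over half the radius.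
    have hLb (y : ℂ) (hy : y ∈ Metric.ball (0 : ℂ) (ρ / 2)) : ‖L y‖ ≤ 2 * (M₀ * (1 + ρ)) := by
      have hyρ := mem_ball_zero_iff.1 hy
      refine (Complex.borelCaratheodory_zero hM hL hre hρ
        (Metric.ball_subset_ball (by linarith) hy) hL0).trans ?_
      rw [div_le_iff₀ (by linarith)]
      refine mul_le_mul_of_nonneg_left (by linarith) (by positivity)
    -- Symmetrizing removes the linear term of L, so Q vanishes to second order at 0. Schwarz's
    -- lemma gives |Q(z)| = O(ρ)(|z|/ρ)², which tends to 0; without the cancellation only O(|z|)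
    -- would remain.
    set Q : ℂ → ℂ := fun y => L y + L (-y) with hQ
    have hneg (y : ℂ) (r : ℝ) (hy : y ∈ Metric.ball (0 : ℂ) r) : -y ∈ Metric.ball (0 : ℂ) r := by
      simpa using hy
    have hQ0 : Q 0 = 0 := by simp [hQ, hL0]
    have hsub : Metric.ball (0 : ℂ) (ρ / 2) ⊆ Metric.ball 0 ρ :=
      Metric.ball_subset_ball (by linarith)
    have hQd : DifferentiableOn ℂ Q (Metric.ball 0 (ρ / 2)) :=
      (hL.mono hsub).add (hL.comp (by fun_prop) fun y hy => hneg y _ (hsub hy))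
    have hQder : HasDerivAt Q 0 0 := by
      have h1 : HasDerivAt L (deriv L 0) 0 :=
        (hL.differentiableAt (Metric.isOpen_ball.mem_nhds (Metric.mem_ball_self hρ))).hasDerivAt
      have h2 : HasDerivAt (fun y => L (-y)) (-deriv L 0) 0 := by
        have h3 : HasDerivAt L (deriv L 0) (-0) := by rwa [neg_zero]
        simpa using! h3.comp (0 : ℂ) (hasDerivAt_neg (0 : ℂ))
      exact (h1.add h2).congr_deriv (add_neg_cancel _)
    have hmaps : MapsTo Q (Metric.ball 0 (ρ / 2))
        (Metric.closedBall (Q 0) (4 * (M₀ * (1 + ρ)))) := fun y hy => by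
      rw [hQ0, mem_closedBall_zero_iff]
      refine (norm_add_le _ _).trans ?_
      linarith [hLb y hy, hLb (-y) (hneg y _ hy)]
    have hzb : z ∈ Metric.ball (0 : ℂ) (ρ / 2) := by
      rw [mem_ball_zero_iff]
      linarith
    have hQz := Complex.dist_le_mul_div_pow_of_mapsTo_ball_of_isLittleO (n := 1) hQd hmaps
      (by
        have := hasDerivAt_iff_isLittleO.1 hQder
        simpa using this.norm_right) hzb
    rw [hQ0, dist_zero_right, dist_zero_right] at hQz
    have hEE : ‖E z * E (-z)‖ ≤ ‖f 0‖ ^ 2 *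
        Real.exp (4 * (M₀ * (1 + ρ)) * (‖z‖ / (ρ / 2)) ^ 2) := by
      have e : E z * E (-z) = f 0 ^ 2 * Complex.exp (Q z) := by
        rw [hEL z (hsub hzb), hEL (-z) (hneg z _ (hsub hzb)), hE00, hQ, Complex.exp_add]
        ring
      rw [e, norm_mul, norm_pow, Complex.norm_exp]
      gcongr
      exact (Complex.re_le_norm _).trans hQz
    have hprod (y : ℂ) : ‖∏ w ∈ S, (1 - y / w) ^ m w‖ ≤ Real.exp (σ / α * ‖y‖ ^ α) := by
      have h1 : ‖∏ w ∈ S, (1 - y / w) ^ m w‖ ≤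
          ∏ w ∈ S, Real.exp ((m w : ℝ) * (1 / ‖w‖ ^ α) * (‖y‖ ^ α / α)) := by
        rw [norm_prod]
        refine Finset.prod_le_prod (fun _ _ => norm_nonneg _) fun w hw => ?_
        have h2 : ‖1 - y / w‖ ≤ 1 + ‖y‖ / ‖w‖ := by
          simpa using norm_sub_le 1 (y / w)
        have h3 := h2.trans (one_add_le_exp_rpow_div (by positivity) hα hα1)
        rw [norm_pow]
        refine (pow_le_pow_left₀ (norm_nonneg _) h3 _).trans (le_of_eq ?_)
        rw [← Real.exp_nat_mul, Real.div_rpow (norm_nonneg _) (norm_nonneg _)]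
        congr 1
        ring
      rw [← Real.exp_sum, ← Finset.sum_mul] at h1
      refine h1.trans ?_
      have h4 : ∑ w ∈ S, (m w : ℝ) * (1 / ‖w‖ ^ α) ≤ σ := by
        rw [← Finset.sum_subtype_of_mem (fun w : ℂ => (m w : ℝ) * (1 / ‖w‖ ^ α))
          (p := fun z : ℂ => f z = 0 ∧ z ≠ 0)
          fun w hw => ⟨((hmemS w).1 hw).1, hne0 w ((hmemS w).1 hw).1⟩]
        exact hs.sum_le_tsum _ fun _ _ => by positivity
      rw [Real.exp_le_exp]
      calc _ ≤ σ * (‖y‖ ^ α / α) := by gcongr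
        _ = _ := by ring
    have h1 := hprod z
    have h2 := hprod (-z)
    rw [norm_neg] at h2
    calc ‖f z * f (-z)‖ = ‖∏ w ∈ S, (1 - z / w) ^ m w‖ * ‖∏ w ∈ S, (1 - -z / w) ^ m w‖ *
          ‖E z * E (-z)‖ := by
          rw [hfE z, hfE (-z)]
          simp only [norm_mul]
          ring
      _ ≤ Real.exp (σ / α * ‖z‖ ^ α) * Real.exp (σ / α * ‖z‖ ^ α) * (‖f 0‖ ^ 2 *
          Real.exp (4 * (M₀ * (1 + ρ)) * (‖z‖ / (ρ / 2)) ^ 2)) := by gcongr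
      _ = _ := by
          rw [← Real.exp_add]
          ring_nf
  have hlim : Tendsto (fun ρ : ℝ => 4 * (M₀ * (1 + ρ)) * (‖z‖ / (ρ / 2)) ^ 2) atTop (𝓝 0) := by
    have h1 : Tendsto (fun ρ : ℝ => 16 * M₀ * ‖z‖ ^ 2 * ((ρ⁻¹) ^ 2 + ρ⁻¹)) atTop
        (𝓝 (16 * M₀ * ‖z‖ ^ 2 * (0 ^ 2 + 0))) :=
      ((tendsto_inv_atTop_zero.pow 2).add tendsto_inv_atTop_zero).const_mul _
    rw [show 16 * M₀ * ‖z‖ ^ 2 * ((0 : ℝ) ^ 2 + 0) = 0 by ring] at h1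
    refine h1.congr' ?_
    filter_upwards [eventually_gt_atTop 0] with ρ hρ
    field_simp
    ring
  have hfinal := ge_of_tendsto (((Real.continuous_exp.tendsto 0).comp hlim).const_mul
    (‖f 0‖ ^ 2 * Real.exp (2 * (σ / α) * ‖z‖ ^ α))) key
  simpa using hfinal

/-! ### Order, type and convergence exponent -/

theorem norm_mul_exp_I_mul {r : ℝ} (hr : 0 ≤ r) (θ : ℝ) :
    ‖(r : ℂ) * Complex.exp (Complex.I * θ)‖ = r := by
  rw [norm_mul, mul_comm Complex.I, Complex.norm_exp_ofReal_mul_I, mul_one, Complex.norm_real,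
    Real.norm_eq_abs, abs_of_nonneg hr]

theorem maxModulus_nonneg (f : ℂ → ℂ) (r : ℝ) : 0 ≤ maxModulus f r := by
  refine Real.sSup_nonneg ?_
  rintro _ ⟨θ, -, rfl⟩
  exact norm_nonneg _

theorem maxModulus_le {f : ℂ → ℂ} {r B : ℝ} (hr : 0 ≤ r) (h : ∀ z, ‖z‖ = r → ‖f z‖ ≤ B) :
    maxModulus f r ≤ B := by
  refine csSup_le ((nonempty_Icc.2 Real.two_pi_pos.le).image _) ?_
  rintro _ ⟨θ, -, rfl⟩
  exact h _ (norm_mul_exp_I_mul hr θ)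

theorem norm_neg_I_mul_le_maxModulus {f : ℂ → ℂ} (hf : Continuous f) (r : ℝ) :
    ‖f (-Complex.I * r)‖ ≤ maxModulus f r := by
  refine le_csSup (isCompact_Icc.image (by fun_prop)).bddAbove
    ⟨3 * Real.pi / 2, ⟨by positivity, by linarith [Real.pi_pos]⟩, ?_⟩
  have h : Complex.exp (Complex.I * ((3 * Real.pi / 2 : ℝ) : ℂ)) = -Complex.I := by
    rw [show Complex.I * ((3 * Real.pi / 2 : ℝ) : ℂ) =
      Real.pi / 2 * Complex.I + Real.pi * Complex.I by push_cast; ring, Complex.exp_add,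
      Complex.exp_pi_div_two_mul_I, Complex.exp_pi_mul_I]
    ring
  simp only [h]
  rw [mul_comm]

/-- The maximum modulus dominates the modulus on any single ray, so a lower bound along the negative
imaginary axis is enough for both the order and the type. -/
theorem hasOrderAndType_one_of_bounds {f : ℂ → ℂ} (hf : Continuous f) {T : ℝ} (hT : 0 < T)
    {r₀ C : ℝ} (hupper : ∀ z, r₀ ≤ ‖z‖ → ‖f z‖ ≤ C * Real.exp (T * ‖z‖))
    (hlower : ∀ ε, 0 < ε →
      ∀ᶠ κ : ℝ in atTop, Real.exp ((T - ε) * κ) ≤ ‖f (-Complex.I * κ)‖) :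
    HasOrderAndType f 1 T := by
  have hO {g : ℝ → ℝ} (hg : ∀ᶠ r in atTop, T * r ≤ g r) :
      maxModulus f =O[atTop] fun r => Real.exp (g r) := by
    refine Asymptotics.IsBigO.of_bound |C| ?_
    filter_upwards [hg, eventually_ge_atTop 0, eventually_ge_atTop r₀] with r hr hr0 hr1
    rw [Real.norm_eq_abs, abs_of_nonneg (maxModulus_nonneg f r), Real.norm_eq_abs, Real.abs_exp]
    refine maxModulus_le hr0 fun z hz => ?_
    have h1 := hupper z (hz ▸ hr1)
    rw [hz] at h1
    calc _ ≤ _ := h1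
      _ ≤ |C| * Real.exp (T * r) :=
        mul_le_mul_of_nonneg_right (le_abs_self C) (Real.exp_pos _).le
      _ ≤ _ := by gcongr
  have hnO {g : ℝ → ℝ} {ε : ℝ} (hε : 0 < ε)
      (hg : Tendsto (fun r => (T - ε) * r - g r) atTop atTop) :
      ¬ maxModulus f =O[atTop] fun r => Real.exp (g r) := by
    intro h
    obtain ⟨c, hc⟩ := h.bound
    obtain ⟨r, h1, h2, h3⟩ := (hc.and ((hlower ε hε).and
      (hg.eventually_gt_atTop (Real.log (|c| + 1))))).exists
    rw [Real.norm_eq_abs, abs_of_nonneg (maxModulus_nonneg f r), Real.norm_eq_abs,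
      Real.abs_exp] at h1
    have h4 := h2.trans ((norm_neg_I_mul_le_maxModulus hf r).trans h1)
    have hc0 : 0 < |c| + 1 := by positivity
    rw [Real.log_lt_iff_lt_exp hc0, Real.exp_sub, lt_div_iff₀ (Real.exp_pos _)] at h3
    have h5 : c * Real.exp (g r) ≤ (|c| + 1) * Real.exp (g r) :=
      mul_le_mul_of_nonneg_right (by linarith [le_abs_self c]) (Real.exp_pos _).le
    linarith
  refine ⟨⟨zero_le_one, fun ε hε => hO ?_, fun ε hε => hnO (half_pos hT) ?_⟩, one_pos, hT.le,
    fun ε hε => hO ?_, fun ε hε => hnO (ε := -ε / 2) (by linarith) ?_⟩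
  · filter_upwards [(tendsto_rpow_atTop hε).eventually_ge_atTop T, eventually_gt_atTop 0]
      with r hr hr0
    rw [Real.rpow_add hr0, Real.rpow_one, mul_comm]
    gcongr
  · have h1 : Tendsto (fun r : ℝ => (T - T / 2) - r ^ ε) atTop (𝓝 ((T - T / 2) - 0)) := by
      have := tendsto_rpow_neg_atTop (neg_pos.2 hε)
      rw [neg_neg] at this
      exact tendsto_const_nhds.sub this
    refine (tendsto_id.atTop_mul_pos (by linarith) h1).congr' ?_
    filter_upwards [eventually_gt_atTop 0] with r hr0
    rw [Real.rpow_add hr0, Real.rpow_one, id]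
    ring
  · filter_upwards [eventually_ge_atTop 0] with r hr
    rw [Real.rpow_one]
    gcongr
    linarith
  · have : Tendsto (fun r : ℝ => -ε / 2 * r) atTop atTop :=
      tendsto_id.const_mul_atTop (by linarith)
    refine this.congr fun r => ?_
    rw [Real.rpow_one]
    ring

theorem exists_norm_le_mul_exp {f : ℂ → ℂ} (hf : Continuous f) {r₀ C c : ℝ} (hc : 0 ≤ c)
    (h : ∀ z, r₀ ≤ ‖z‖ → ‖f z‖ ≤ C * Real.exp (c * ‖z‖)) :
    ∃ C', ∀ z, ‖f z‖ ≤ C' * Real.exp (c * ‖z‖) := by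
  obtain ⟨B, hB⟩ := (isCompact_closedBall (0 : ℂ) r₀).exists_bound_of_continuousOn hf.continuousOn
  refine ⟨|C| + |B|, fun z => ?_⟩
  have hexp : 1 ≤ Real.exp (c * ‖z‖) := Real.one_le_exp (by positivity)
  rcases le_total r₀ ‖z‖ with hz | hz
  · refine (h z hz).trans (mul_le_mul_of_nonneg_right ?_ (Real.exp_pos _).le)
    linarith [le_abs_self C, abs_nonneg B]
  · have h1 := hB z (mem_closedBall_zero_iff.2 hz)
    have h2 := le_abs_self B
    nlinarith [abs_nonneg C, abs_nonneg B]

/-- An entire function of exponential type that tends to one along the positive and grows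
exponentially along the negative imaginary axis has zeros of convergence exponent one. -/
theorem hasConvergenceExponent_one {f : ℂ → ℂ} (hf : Differentiable ℂ f) {C c : ℝ} (hc : 0 ≤ c)
    (hfC : ∀ z, ‖f z‖ ≤ C * Real.exp (c * ‖z‖))
    (hup : Tendsto (fun κ : ℝ => f (Complex.I * κ)) atTop (𝓝 1)) {b : ℝ} (hb : 0 < b)
    (hdown : ∀ᶠ κ : ℝ in atTop, Real.exp (b * κ) ≤ ‖f (-Complex.I * κ)‖) :
    HasConvergenceExponent f 1 := by
  obtain ⟨κ₁, hκ₁⟩ := hdown.exists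
  have hne : f (-Complex.I * κ₁) ≠ 0 := norm_pos_iff.1 ((Real.exp_pos _).trans_le hκ₁)
  -- A possible zero at the origin is divided out; the other zeros and their multiplicities are
  -- unchanged.
  obtain ⟨g, hg, hg0, hfg⟩ := exists_eq_pow_mul_of_entire hf
    (analyticOrderAt_ne_top_of_apply_ne_zero hf hne 0)
  set n := analyticOrderNatAt f 0
  simp only [sub_zero] at hfg
  obtain ⟨C', hgC⟩ : ∃ C', ∀ z, ‖g z‖ ≤ C' * Real.exp (c * ‖z‖) := by
    refine exists_norm_le_mul_exp hg.continuous hc (r₀ := 1) (C := C) fun z hz => ?_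
    refine le_trans ?_ (hfC z)
    rw [hfg z, norm_mul, norm_pow]
    exact le_mul_of_one_le_left (norm_nonneg _) (one_le_pow₀ hz)
  have hord (z : ℂ) (hz : z ≠ 0) : analyticOrderNatAt f z = analyticOrderNatAt g z := by
    have h1 : f = (fun z => z ^ n) * g := funext hfg
    have h2 : analyticOrderAt (fun z : ℂ => z ^ n) z = 0 :=
      analyticOrderAt_eq_zero.2 (Or.inr (pow_ne_zero _ hz))
    rw [analyticOrderNatAt, analyticOrderNatAt, h1,
      analyticOrderAt_mul (by fun_prop) (hg.analyticAt z), h2, zero_add]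
  have hzero (z : ℂ) : (g z = 0 ∧ z ≠ 0) ↔ (f z = 0 ∧ z ≠ 0) := by
    refine and_congr_left fun hz => ?_
    rw [hfg z, mul_eq_zero, or_iff_right (pow_ne_zero _ hz)]
  have hsum (α : ℝ) : (Summable fun z : {z : ℂ // f z = 0 ∧ z ≠ 0} =>
        (analyticOrderNatAt f z : ℝ) * (1 / ‖(z : ℂ)‖ ^ α)) ↔
      Summable fun z : {z : ℂ // g z = 0 ∧ z ≠ 0} =>
        (analyticOrderNatAt g z : ℝ) * (1 / ‖(z : ℂ)‖ ^ α) := by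
    rw [← (Equiv.subtypeEquivRight hzero).summable_iff]
    refine summable_congr fun z => ?_
    simp only [Function.comp_apply, Equiv.subtypeEquivRight_apply_coe]
    rw [hord z z.2.2]
  refine ⟨fun α ⟨hα, hs⟩ => ?_, fun β hβ => ?_⟩
  · by_contra hα1
    push Not at hα1
    -- At z = iκ the product |f(z) f(-z)| exceeds e^{bκ}/2, but it would be at most κ^{2n} ‖g 0‖²
    -- e^{Aκ^α}. For α < 1 the last exponential is eventually below e^{bκ/2}, and the remaining
    -- e^{bκ/2} beats the power of κ.
    obtain ⟨A, hA⟩ := norm_mul_neg_le_of_summable hg hg0 hgC hα hα1.le ((hsum α).1 hs)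
    have hg0' : 0 < ‖g 0‖ := norm_pos_iff.2 hg0
    have h1 : ∀ᶠ κ : ℝ in atTop, 1 / 2 < ‖f (Complex.I * κ)‖ :=
      hup.norm.eventually (lt_mem_nhds (by rw [norm_one]; norm_num))
    have h2 : ∀ᶠ κ : ℝ in atTop, A * κ ^ α ≤ b / 2 * κ := by
      have h3 : Tendsto (fun κ : ℝ => A * κ ^ (-(1 - α))) atTop (𝓝 (A * 0)) :=
        (tendsto_rpow_neg_atTop (by linarith)).const_mul A
      rw [mul_zero] at h3
      filter_upwards [h3.eventually (gt_mem_nhds (half_pos hb)), eventually_gt_atTop 0]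
        with κ h4 h5
      have h6 : κ ^ α = κ ^ (-(1 - α)) * κ := by
        rw [← Real.rpow_add_one h5.ne']
        congr 1
        ring
      rw [h6, ← mul_assoc]
      gcongr
    have h3 : ∀ᶠ κ : ℝ in atTop, ‖κ ^ (2 * n)‖ ≤
        1 / (4 * ‖g 0‖ ^ 2) * ‖Real.exp (b / 2 * κ)‖ :=
      (isLittleO_pow_exp_pos_mul_atTop (2 * n) (half_pos hb)).bound (by positivity)
    obtain ⟨κ, k1, k2, k3, k4, k5⟩ :=
      (h1.and (h2.and (h3.and (hdown.and (eventually_gt_atTop 0))))).exists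
    have hn : ‖Complex.I * κ‖ = κ := by simp [abs_of_pos k5]
    have e1 := hA (Complex.I * κ)
    rw [hn, norm_mul] at e1
    rw [neg_mul, hfg, norm_mul, norm_pow, norm_neg, hn] at k4
    rw [hfg, norm_mul, norm_pow, hn] at k1
    rw [Real.norm_eq_abs, Real.norm_eq_abs, Real.abs_exp, abs_of_pos (by positivity),
      div_mul_eq_mul_div, one_mul, le_div_iff₀ (by positivity)] at k3
    have e2 : 1 / 2 * Real.exp (b * κ) ≤
        κ ^ (2 * n) * (‖g 0‖ ^ 2 * Real.exp (b / 2 * κ)) := by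
      calc 1 / 2 * Real.exp (b * κ) ≤ (κ ^ n * ‖g (Complex.I * κ)‖) *
            (κ ^ n * ‖g (-(Complex.I * κ))‖) := by gcongr
        _ = κ ^ (2 * n) * (‖g (Complex.I * κ)‖ * ‖g (-(Complex.I * κ))‖) := by ring
        _ ≤ κ ^ (2 * n) * (‖g 0‖ ^ 2 * Real.exp (A * κ ^ α)) := by gcongr
        _ ≤ _ := by gcongr
    have e3 : Real.exp (b * κ) = Real.exp (b / 2 * κ) * Real.exp (b / 2 * κ) := by
      rw [← Real.exp_add]
      ring_nf
    have e4 := mul_le_mul_of_nonneg_right k3 (Real.exp_pos (b / 2 * κ)).le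
    have e5 := Real.exp_pos (b * κ)
    rw [← e3] at e4
    nlinarith
  · refine le_of_forall_pos_le_add fun ε hε => hβ ⟨by linarith, ?_⟩
    exact (hsum _).2 (summable_order_div_rpow hg hg0 hgC (by linarith))

theorem tendsto_jostFunction_I_mul {V : ℝ → ℝ} {R : ℝ} (hR : 0 ≤ R)
    (hV : Integrable V) (hV0 : ∀ r, R < r → V r = 0) :
    Tendsto (fun κ : ℝ => jostFunction V R (Complex.I * κ)) atTop (𝓝 1) := by
  rw [tendsto_iff_norm_sub_tendsto_zero]
  refine squeeze_zero' (Eventually.of_forall fun _ => norm_nonneg _) ?_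
    (tendsto_const_nhds (x := 2 * ∫ s, |V s|).div_atTop tendsto_id)
  filter_upwards [eventually_gt_atTop 0, eventually_ge_atTop (2 * ∫ s, |V s|)] with κ h1 h2
  have hn : ‖Complex.I * κ‖ = κ := by simp [abs_of_pos h1]
  have := norm_jostFunction_sub_one_le hR hV hV0 (k := Complex.I * κ) (by rwa [hn]) (by rwa [hn])
    (by simpa using h1.le)
  rwa [hn] at this

end JostScattering

end

/-! ### Order, type and zeros of the Jost function -/

theorem mainTheorem6 (V : ℝ → ℝ) (R : ℝ)
    (hV_ne : ¬ V =ᵐ[volume] 0)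
    (hV_int : Integrable V)
    (hV_supp : Function.support V ⊆ Icc 0 R)
    (hV_sup : IsLUB (tsupport V) R)
    (M : ℕ) (d δ : Fin (M + 1) → ℝ)
    (hδ_gt : -1 < δ 0) (hδ_mono : StrictMono δ) (hd : ∃ n, d n ≠ 0)
    (hV_asymp : Tendsto (fun r : ℝ => V r / ∑ n, d n * (R - r) ^ δ n) (𝓝[<] R) (𝓝 1)) :
    Differentiable ℂ (JostScattering.jostFunction V R) ∧
      JostScattering.HasOrder (JostScattering.jostFunction V R) 1 ∧
      JostScattering.HasOrderAndType (JostScattering.jostFunction V R) 1 (2 * R) ∧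
      JostScattering.IsOfExponentialType (JostScattering.jostFunction V R) ∧
      JostScattering.HasConvergenceExponent (JostScattering.jostFunction V R) 1 := by
  have hV0 : ∀ r, R < r → V r = 0 := fun r hr => by
    by_contra h
    exact hr.not_ge (hV_supp h).2
  -- Otherwise V would be supported in the null set {0}.
  have hR : 0 < R := by
    by_contra hR
    push Not at hR
    refine hV_ne ?_
    have hne : ∀ᵐ s : ℝ, s ≠ 0 := by simp [ae_iff, measure_singleton]
    filter_upwards [hne] with s hs
    by_contra h
    obtain ⟨h1, h2⟩ := hV_supp h
    exact hs (le_antisymm (h2.trans hR) h1)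
  obtain ⟨σ, hσ, η, hη, hsign⟩ := JostScattering.exists_sign_potential hδ_mono hd hV_asymp
  have hdiff := JostScattering.differentiable_jostFunction hR.le hV_int hV0
  have hlower := fun ε (hε : 0 < ε) =>
    JostScattering.eventually_exp_le_norm_jostFunction hR hV_int hV0 hσ hη hsign hε
  have hN : 0 ≤ ∫ s, |V s| := integral_nonneg fun _ => abs_nonneg _
  -- The added 1 keeps z away from the origin even if only ‖V‖₁ ≥ 0 is known.
  have hupper : ∀ z : ℂ, 2 * (∫ s, |V s|) + 1 ≤ ‖z‖ →
      ‖JostScattering.jostFunction V R z‖ ≤ 2 * Real.exp (2 * R * ‖z‖) := fun z hz =>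
    JostScattering.norm_jostFunction_le hR.le hV_int hV0 (by linarith) (by linarith)
  have htype := JostScattering.hasOrderAndType_one_of_bounds hdiff.continuous
    (by linarith : 0 < 2 * R) hupper hlower
  obtain ⟨C, hC⟩ := JostScattering.exists_norm_le_mul_exp hdiff.continuous (by linarith) hupper
  refine ⟨hdiff, htype.hasOrder, htype, ⟨hdiff, Or.inl ⟨_, htype⟩⟩, ?_⟩
  exact JostScattering.hasConvergenceExponent_one hdiff (by linarith) hC
    (JostScattering.tendsto_jostFunction_I_mul hR.le hV_int hV0)
    -- Any positive rate contradicts order below one; here ε = R gives the rate R.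
    (show 0 < 2 * R - R by linarith) (hlower R hR)
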